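/- Let $(M,g)$ be a connected Hausdorff smooth four-dimensional manifold with a smooth Lorentzian metric of signature $(+,-,-,-)$, and let $\mathrm{Iso}$ be its isometry group with the compact-open topology. A Killing pair is an ordered pair $\xi=(\xi_1,\xi_2)$ of smooth, complete, commuting Killing fields which are linearly independent and span a spacelike plane at every point. Its flow is $\varphi_{\xi,s}=\varphi_{\xi_1,s_1}\circ\varphi_{\xi_2,s_2}\in\mathrm{Iso}$, $s\in\mathbb R^2$. For $h\in\mathrm{Iso}$ and $N\in \mathrm{GL}(2,\mathbb R)$ put $h_*\xi=(h_*\xi_1,h_*\xi_2)$, $(N\xi)_i=\sum_j N_{ij}\xi_j$ and $\xi'=(\xi_2,\xi_1)$. Let $U$ be a strongly continuous unitary representation of $\mathrm{Iso}$ on a complex Hilbert space $\mathcal H$, $\alpha_h(T)=U(h)TU(h)^{-1}$, and let $\mathfrak F\subset\mathcal B(\mathcal H)$ be a $C^*$-algebra with $\alpha_h(\mathfrak F)\subset\mathfrak F$ for all $h$, on which $\alpha$ is strongly continuous. Put $U_\xi(s)=U(\varphi_{\xi,s})$. An $F\in\mathfrak F$ is $\xi$-smooth if $s\mapsto U_\xi(s)FU_\xi(s)^{-1}$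 is smooth in norm. Let $\mathcal H^\infty$ be the space of vectors $\Psi$ for which $h\mapsto U(h)\Psi$ is smooth on the Lie group $\mathrm{Iso}$. With $Q=\left(\begin{smallmatrix}0&1\\-1&0\end{smallmatrix}\right)$, $\lambda\in\mathbb R$, a $\xi$-smooth $F\in\mathfrak F$ and $\Psi\in\mathcal H^\infty$, set $$F_{\xi,\lambda}\Psi=\frac1{4\pi^2}\lim_{\varepsilon\downarrow0}\int_{\mathbb R^2\times\mathbb R^2} ds\,ds'\,e^{-i s\cdot s'}\chi(\varepsilon s,\varepsilon s')\,U_\xi(\lambda Qs)FU_\xi(s'-\lambda Qs)\Psi ,$$ where $\chi\in C_0^\infty(\mathbb R^2\times\mathbb R^2)$, $\chi(0,0)=1$; the operator $F_{\xi,\lambda}$ is the extension by continuity (the closure) of this operator on $\mathcal H^\infty$. Let $\xi$ be a Killing pair, $\lambda\in\mathbb R$, and let $F\in\mathfrak F$ be $\xi$-smooth. Then the limit above exists for every $\Psi\in\mathcal H^\infty$ and every $\chi$, and does not depend on $\chi$. Moreover: a) For every $h\in\mathrm{Iso}$, $h_*\xi$ is a Killing pair, $\alpha_h(F)\in\mathfrak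 F$ is $h_*\xi$-smooth, and $\alpha_h(F_{\xi,\lambda})=\alpha_h(F)_{h_*\xi,\lambda}$. b) For every $N\in \mathrm{GL}(2,\mathbb R)$, $N\xi$ is a Killing pair, $F$ is $N\xi$-smooth, and $F_{N\xi,\lambda}=F_{\xi,\det N\cdot\lambda}$. In particular, $F_{\xi',\lambda}=F_{\xi,-\lambda}$. -/

import Mathlib

open scoped Manifold ContDiff Topology
open MeasureTheory

noncomputable section

namespace Warped

/-! ### Spacetimes, isometries, Killing pairs -/

section Geometry

variable {M : Type*} [TopologicalSpace M] [ChartedSpace (EuclideanSpace ℝ (Fin 4)) M]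

/-- Vector fields on a four-dimensional manifold `M` (no regularity imposed). -/
abbrev VField (M : Type*) [TopologicalSpace M] [ChartedSpace (EuclideanSpace ℝ (Fin 4)) M] :=
  ∀ p : M, TangentSpace (𝓡 4) p

variable (M) in
/-- A smooth Lorentzian metric of signature `(+,-,-,-)` on the four-dimensional manifold `M`. -/
structure LorentzMetric [IsManifold (𝓡 4) ∞ M] where
  /-- The bilinear form on each tangent space. -/
  val (p : M) : TangentSpace (𝓡 4) p →L[ℝ] TangentSpace (𝓡 4) p →L[ℝ] ℝ
  symm (p : M) (v w : TangentSpace (𝓡 4) p) : val p v w = val p w v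
  signature (p : M) : ∃ b : Module.Basis (Fin 4) ℝ (TangentSpace (𝓡 4) p), ∀ i j,
    val p (b i) (b j) = if i = j then (if i = 0 then 1 else -1) else 0
  contMDiff : ContMDiff (𝓡 4)
    ((𝓡 4).prod 𝓘(ℝ, EuclideanSpace ℝ (Fin 4) →L[ℝ] EuclideanSpace ℝ (Fin 4) →L[ℝ] ℝ)) ∞
    (fun p ↦ Bundle.TotalSpace.mk'
      (EuclideanSpace ℝ (Fin 4) →L[ℝ] EuclideanSpace ℝ (Fin 4) →L[ℝ] ℝ)
      (E := fun p : M ↦ TangentSpace (𝓡 4) p →L[ℝ] TangentSpace (𝓡 4) p →L[ℝ] ℝ) p (val p))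

variable [IsManifold (𝓡 4) ∞ M]

/-- The isometry group of `(M, g)`: all smooth diffeomorphisms of `M` with `h^* g = g`. -/
def Iso (g : LorentzMetric M) : Subgroup (Equiv.Perm M) where
  carrier := {h | ContMDiff (𝓡 4) (𝓡 4) ∞ h ∧ ContMDiff (𝓡 4) (𝓡 4) ∞ h.symm ∧
    ∀ (p : M) (v w : TangentSpace (𝓡 4) p),
      g.val (h p) (mfderiv (𝓡 4) (𝓡 4) h p v) (mfderiv (𝓡 4) (𝓡 4) h p w) = g.val p v w}
  one_mem' := by
    refine ⟨contMDiff_id, contMDiff_id, fun p v w ↦ ?_⟩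
    have : mfderiv (𝓡 4) (𝓡 4) (1 : Equiv.Perm M) p
        = ContinuousLinearMap.id ℝ (TangentSpace (𝓡 4) p) := mfderiv_id
    rw [this]; rfl
  mul_mem' := by
    rintro a b ⟨ha, ha', hag⟩ ⟨hb, hb', hbg⟩
    refine ⟨ha.comp hb, hb'.comp ha', fun p v w ↦ ?_⟩
    have : mfderiv (𝓡 4) (𝓡 4) (a * b : Equiv.Perm M) p
        = (mfderiv (𝓡 4) (𝓡 4) a (b p)).comp (mfderiv (𝓡 4) (𝓡 4) b p) :=
      mfderiv_comp p (ha.mdifferentiable (by simp) _) (hb.mdifferentiable (by simp) _)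
    rw [this]
    exact (hag (b p) _ _).trans (hbg p v w)
  inv_mem' := by
    rintro a ⟨ha, ha', hag⟩
    refine ⟨ha', ha, fun p v w ↦ ?_⟩
    have h1 : (mfderiv (𝓡 4) (𝓡 4) a (a.symm p)).comp (mfderiv (𝓡 4) (𝓡 4) a.symm p)
        = ContinuousLinearMap.id ℝ (TangentSpace (𝓡 4) p) := by
      have := mfderiv_comp p (ha.mdifferentiable (by simp) _) (ha'.mdifferentiable (by simp) p)
      rw [← this, ← mfderiv_id]
      congr 1
      ext x; simp
    have h2 : ∀ v : TangentSpace (𝓡 4) p,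
        mfderiv (𝓡 4) (𝓡 4) a (a.symm p) (mfderiv (𝓡 4) (𝓡 4) a.symm p v) = v :=
      fun v ↦ DFunLike.congr_fun h1 v
    have h3 := hag (a.symm p) (mfderiv (𝓡 4) (𝓡 4) a.symm p v)
      (mfderiv (𝓡 4) (𝓡 4) a.symm p w)
    have h4 : ∀ q, q = p → ∀ v w : EuclideanSpace ℝ (Fin 4),
      (g.val q : EuclideanSpace ℝ (Fin 4) →L[ℝ] EuclideanSpace ℝ (Fin 4) →L[ℝ] ℝ) v w
       = (g.val p : EuclideanSpace ℝ (Fin 4) →L[ℝ] EuclideanSpace ℝ (Fin 4) →L[ℝ] ℝ) v w := by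
      rintro q rfl v w; rfl
    exact h3.symm.trans ((congrArg₂ (fun x y ↦ (g.val (a (a.symm p)) :
        EuclideanSpace ℝ (Fin 4) →L[ℝ] EuclideanSpace ℝ (Fin 4) →L[ℝ] ℝ) x y)
        (h2 v) (h2 w)).trans (h4 _ (a.apply_symm_apply p) v w))

/-- An isometry as a continuous map. -/
def Iso.toContinuousMap (g : LorentzMetric M) (h : Iso g) : C(M, M) :=
  ⟨(h : Equiv.Perm M), h.2.1.continuous⟩

/-- The isometry group carries the compact-open topology. -/
instance (g : LorentzMetric M) : TopologicalSpace (Iso g) :=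
  TopologicalSpace.induced (Iso.toContinuousMap g) inferInstance

/-- `φ` is the global flow of the vector field `X`: a smooth one-parameter group of
transformations of `M` whose orbits are integral curves of `X`. -/
structure IsFlow (X : VField M) (φ : ℝ → M → M) : Prop where
  contMDiff : ContMDiff (𝓘(ℝ, ℝ).prod (𝓡 4)) (𝓡 4) ∞ (fun z : ℝ × M ↦ φ z.1 z.2)
  zero (p : M) : φ 0 p = p
  add (s t : ℝ) (p : M) : φ (s + t) p = φ s (φ t p)
  integralCurve (p : M) : IsMIntegralCurve (fun t ↦ φ t p) X

/-- A vector field is complete if it has a global flow. -/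
def IsComplete (X : VField M) : Prop := ∃ φ, IsFlow X φ

open Classical in
/-- The flow of a complete vector field (the identity if `X` is not complete). -/
def flow (X : VField M) : ℝ → M → M :=
  if h : IsComplete X then h.choose else fun _ p ↦ p

/-- The Lie derivative of `g` along the complete field `X` vanishes, i.e.
`d/dt (φ_t^* g) = 0` at `t = 0`, where `φ` is the flow of `X`. -/
def LieDerivVanishes (g : LorentzMetric M) (X : VField M) : Prop :=
  ∀ (p : M) (v w : TangentSpace (𝓡 4) p), HasDerivAt
    (fun t : ℝ ↦ g.val (flow X t p) (mfderiv (𝓡 4) (𝓡 4) (flow X t) p v)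
      (mfderiv (𝓡 4) (𝓡 4) (flow X t) p w)) 0 0

/-- `ξ = (ξ₁, ξ₂)` is an ordered pair of smooth, complete, commuting Killing fields which are
pointwise linearly independent and spacelike (they span a spacelike plane at every point).
Nothing is required of the global structure of `M`. -/
structure IsKillingPair (g : LorentzMetric M) (ξ : Fin 2 → VField M) : Prop where
  smooth (i : Fin 2) : ContMDiff (𝓡 4) (𝓡 4).tangent ∞
    (fun p ↦ (⟨p, ξ i p⟩ : TangentBundle (𝓡 4) M))
  complete (i : Fin 2) : IsComplete (ξ i)
  killing (i : Fin 2) : LieDerivVanishes g (ξ i)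
  commute (p : M) : VectorField.mlieBracket (𝓡 4) (ξ 0) (ξ 1) p = 0
  linearIndependent (p : M) : LinearIndependent ℝ (fun i ↦ ξ i p)
  spacelike (p : M) (c : Fin 2 → ℝ) (hc : c ≠ 0) :
    g.val p (∑ i, c i • ξ i p) (∑ i, c i • ξ i p) < 0

/-- The push-forward `h_* ξ = (h_* ξ₁, h_* ξ₂)`. The push-forward of a field under `h` is its
pull-back under `h⁻¹`: `(h_* X)(p) = dh (X (h⁻¹ p))`. -/
def pushforward {g : LorentzMetric M} (h : Iso g) (ξ : Fin 2 → VField M) : Fin 2 → VField M :=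
  fun i ↦ VectorField.mpullback (𝓡 4) (𝓡 4) (h⁻¹ : Iso g).1 (ξ i)

/-- The pair `N ξ`, `(N ξ)ᵢ = ∑ⱼ Nᵢⱼ ξⱼ`. -/
def linComb (N : Matrix (Fin 2) (Fin 2) ℝ) (ξ : Fin 2 → VField M) : Fin 2 → VField M :=
  fun i p ↦ ∑ j, N i j • ξ j p

/-- The inverted pair `ξ' = (ξ₂, ξ₁)`. -/
def inverted (ξ : Fin 2 → VField M) : Fin 2 → VField M := ![ξ 1, ξ 0]

/-- The Euclidean plane of flow parameters. -/
abbrev Plane := EuclideanSpace ℝ (Fin 2)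

open Classical in
/-- The joint flow `φ_{ξ,s} = φ_{ξ₁,s₁} ∘ φ_{ξ₂,s₂}` as an element of the isometry group
(the identity if that map is not an isometry, which does not happen for Killing pairs). -/
def pairFlow (g : LorentzMetric M) (ξ : Fin 2 → VField M) (s : Plane) : Iso g :=
  if h : ∃ k : Iso g, ∀ p : M, k.1 p = flow (ξ 0) (s 0) (flow (ξ 1) (s 1) p) then h.choose else 1

end Geometry

/-! ### Field algebras and deformed operators -/

section Deformation

variable {M : Type*} [TopologicalSpace M] [ChartedSpace (EuclideanSpace ℝ (Fin 4)) M]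
  [IsManifold (𝓡 4) ∞ M] {H : Type*} [NormedAddCommGroup H] [InnerProductSpace ℂ H]
  [CompleteSpace H]

/-- The adjoint action `α_h(F) = U(h) F U(h)⁻¹` on bounded operators. -/
def adj {g : LorentzMetric M} (U : Iso g →* unitary (H →L[ℂ] H)) (h : Iso g)
    (F : H →L[ℂ] H) : H →L[ℂ] H :=
  (U h : H →L[ℂ] H) * F * (U h⁻¹ : H →L[ℂ] H)

variable (H) in
/-- A concrete `C*`-algebra `𝔉` of operators on a Hilbert space `H` with a strongly continuous
unitary representation `U` of the isometry group, whose adjoint action `α` leaves `𝔉` invariant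
and is strongly continuous on `𝔉`. -/
structure CovariantAlgebra (g : LorentzMetric M) where
  /-- The unitary representation of the isometry group. -/
  U : Iso g →* unitary (H →L[ℂ] H)
  continuous_U (Ψ : H) : Continuous (fun h ↦ (U h : H →L[ℂ] H) Ψ)
  /-- The field algebra. -/
  alg : NonUnitalStarSubalgebra ℂ (H →L[ℂ] H)
  isClosed : IsClosed (alg : Set (H →L[ℂ] H))
  invariant (h : Iso g) (F : H →L[ℂ] H) (hF : F ∈ alg) : adj U h F ∈ alg
  continuous_adj (F : H →L[ℂ] H) (hF : F ∈ alg) : Continuous (fun h ↦ adj U h F)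

variable {g : LorentzMetric M}

/-- `F ∈ 𝔉` is `ξ`-smooth: `s ↦ τ_{ξ,s}(F) = α_{φ_{ξ,s}}(F)` is smooth in norm. -/
def IsSmoothOp (𝒜 : CovariantAlgebra H g) (ξ : Fin 2 → VField M) (F : H →L[ℂ] H) : Prop :=
  F ∈ 𝒜.alg ∧ ContDiff ℝ ∞ (fun s : Plane ↦ adj 𝒜.U (pairFlow g ξ s) F)

/-- A smooth `k`-parameter family of isometries, i.e. a smooth map `ℝᵏ → Iso(M, g)`. -/
def IsSmoothFamily {k : ℕ} (P : EuclideanSpace ℝ (Fin k) → Iso g) : Prop :=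
  ContMDiff ((𝓡 k).prod (𝓡 4)) (𝓡 4) ∞
    (fun z : EuclideanSpace ℝ (Fin k) × M ↦ (P z.1).1 z.2)

/-- The space `H^∞` of vectors `Ψ` for which `h ↦ U(h) Ψ` is smooth on the isometry group.
Smoothness of a function on the (Lie) group of isometries is expressed by smoothness along all
smooth maps `ℝᵏ → Iso(M, g)`; local charts of the group are among these maps. -/
def smoothVectors (U : Iso g →* unitary (H →L[ℂ] H)) : Submodule ℂ H where
  carrier := {Ψ | ∀ (k : ℕ) (P : EuclideanSpace ℝ (Fin k) → Iso g), IsSmoothFamily P →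
    ContDiff ℝ ∞ (fun u ↦ (U (P u) : H →L[ℂ] H) Ψ)}
  zero_mem' := by intro k P _; simpa using contDiff_const
  add_mem' := by
    intro a b ha hb k P hP
    simpa using (ha k P hP).add (hb k P hP)
  smul_mem' := by
    intro c a ha k P hP
    simpa using (ha k P hP).const_smul c

/-- Admissible cutoffs: `χ ∈ C_0^∞(ℝ² × ℝ²)` with `χ(0,0) = 1`. -/
structure IsCutoff (χ : Plane × Plane → ℂ) : Prop where
  contDiff : ContDiff ℝ ∞ χ
  hasCompactSupport : HasCompactSupport χ
  apply_zero : χ 0 = 1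

/-- The action of the antisymmetric matrix `Q = (0 1; -1 0)` on the plane. -/
def Q : Plane →ₗ[ℝ] Plane := Matrix.toEuclideanLin !![0, 1; -1, 0]

/-- The integrand `e^{-i s s'} χ(ε s, ε s') U_ξ(λ Q s) F U_ξ(s' - λ Q s) Ψ`. -/
def integrand (U : Iso g →* unitary (H →L[ℂ] H)) (ξ : Fin 2 → VField M) (lam : ℝ)
    (F : H →L[ℂ] H) (Ψ : H) (χ : Plane × Plane → ℂ) (ε : ℝ) (z : Plane × Plane) : H :=
  (Complex.exp (-Complex.I * ((inner ℝ z.1 z.2 : ℝ) : ℂ)) * χ (ε • z)) •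
    (U (pairFlow g ξ (lam • Q z.1)) : H →L[ℂ] H)
      (F ((U (pairFlow g ξ (z.2 - lam • Q z.1)) : H →L[ℂ] H) Ψ))

/-- The oscillatory integral defining the deformed operator converges at `Ψ` to the value `Φ`,
for every choice of the cutoff. -/
def HasDeformedValue (U : Iso g →* unitary (H →L[ℂ] H)) (ξ : Fin 2 → VField M) (lam : ℝ)
    (F : H →L[ℂ] H) (Ψ Φ : H) : Prop :=
  ∀ χ : Plane × Plane → ℂ, IsCutoff χ →
    (∀ ε : ℝ, 0 < ε → Integrable (integrand U ξ lam F Ψ χ ε)) ∧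
    Filter.Tendsto (fun ε : ℝ ↦ (1 / (4 * (Real.pi : ℂ) ^ 2)) •
      ∫ z : Plane × Plane, integrand U ξ lam F Ψ χ ε z) (𝓝[>] 0) (𝓝 Φ)

theorem exists_isCutoff : ∃ χ : Plane × Plane → ℂ, IsCutoff χ := by
  let f : ContDiffBump (0 : Plane × Plane) := ⟨1, 2, by norm_num, by norm_num⟩
  refine ⟨fun z ↦ (f z : ℂ), Complex.ofRealCLM.contDiff.comp f.contDiff, ?_, ?_⟩
  · exact f.hasCompactSupport.comp_left (g := fun x : ℝ ↦ (x : ℂ)) (by simp)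
  · simp [f.one_of_mem_closedBall (Metric.mem_closedBall_self f.rIn_pos.le)]

theorem HasDeformedValue.unique {U : Iso g →* unitary (H →L[ℂ] H)} {ξ : Fin 2 → VField M}
    {lam : ℝ} {F : H →L[ℂ] H} {Ψ Φ Φ' : H} (h : HasDeformedValue U ξ lam F Ψ Φ)
    (h' : HasDeformedValue U ξ lam F Ψ Φ') : Φ = Φ' := by
  obtain ⟨χ, hχ⟩ := exists_isCutoff
  exact tendsto_nhds_unique (h χ hχ).2 (h' χ hχ).2

theorem HasDeformedValue.add {U : Iso g →* unitary (H →L[ℂ] H)} {ξ : Fin 2 → VField M}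
    {lam : ℝ} {F : H →L[ℂ] H} {Ψ Φ Ψ' Φ' : H} (h : HasDeformedValue U ξ lam F Ψ Φ)
    (h' : HasDeformedValue U ξ lam F Ψ' Φ') :
    HasDeformedValue U ξ lam F (Ψ + Ψ') (Φ + Φ') := by
  intro χ hχ
  obtain ⟨hi, ht⟩ := h χ hχ
  obtain ⟨hi', ht'⟩ := h' χ hχ
  have e : ∀ ε, integrand U ξ lam F (Ψ + Ψ') χ ε
      = fun z ↦ integrand U ξ lam F Ψ χ ε z + integrand U ξ lam F Ψ' χ ε z := by
    intro ε; ext z; simp [integrand]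
  refine ⟨fun ε hε ↦ by rw [e]; exact (hi ε hε).add (hi' ε hε), ?_⟩
  refine (ht.add ht').congr' ?_
  filter_upwards [self_mem_nhdsWithin] with ε hε
  rw [e, integral_add (hi ε hε) (hi' ε hε), smul_add]

theorem HasDeformedValue.smul {U : Iso g →* unitary (H →L[ℂ] H)} {ξ : Fin 2 → VField M}
    {lam : ℝ} {F : H →L[ℂ] H} {Ψ Φ : H} (c : ℂ) (h : HasDeformedValue U ξ lam F Ψ Φ) :
    HasDeformedValue U ξ lam F (c • Ψ) (c • Φ) := by
  intro χ hχ
  obtain ⟨hi, ht⟩ := h χ hχ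
  have e : ∀ ε, integrand U ξ lam F (c • Ψ) χ ε
      = fun z ↦ c • integrand U ξ lam F Ψ χ ε z := by
    intro ε; ext z; simp only [integrand, map_smul]; rw [smul_comm]
  refine ⟨fun ε hε ↦ by rw [e]; exact (hi ε hε).smul c, ?_⟩
  refine (ht.const_smul c).congr fun ε ↦ ?_
  rw [e, integral_smul, smul_comm]

/-- The densely defined deformed operator: its domain consists of the vectors in `H^∞` at which
the limit of the oscillatory integrals exists (that this is all of `H^∞` for a `ξ`-smooth `F` is
a part of the theorem), and its value there is the limit. -/
def deformedCore (U : Iso g →* unitary (H →L[ℂ] H)) (ξ : Fin 2 → VField M) (lam : ℝ)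
    (F : H →L[ℂ] H) : H →ₗ.[ℂ] H where
  domain :=
    { carrier := {Ψ | Ψ ∈ smoothVectors U ∧ ∃ Φ, HasDeformedValue U ξ lam F Ψ Φ}
      zero_mem' := ⟨zero_mem _, 0, fun χ _ ↦ by
        have : ∀ ε, integrand U ξ lam F 0 χ ε = fun _ ↦ 0 := by
          intro ε; ext z; simp [integrand]
        simp [this]⟩
      add_mem' := fun ⟨ha, _, ha'⟩ ⟨hb, _, hb'⟩ ↦ ⟨add_mem ha hb, _, ha'.add hb'⟩
      smul_mem' := fun c _ ⟨ha, _, ha'⟩ ↦ ⟨Submodule.smul_mem _ c ha, _, ha'.smul c⟩ }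
  toFun :=
    { toFun := fun Ψ ↦ Ψ.2.2.choose
      map_add' := fun a b ↦
        (a + b).2.2.choose_spec.unique (a.2.2.choose_spec.add b.2.2.choose_spec)
      map_smul' := fun c a ↦ (c • a).2.2.choose_spec.unique (a.2.2.choose_spec.smul c) }

/-- The deformed operator (warped convolution) `F_{ξ,λ}`: the extension by continuity, i.e. the
closure, of the operator given on `H^∞` by the oscillatory integral. For a bounded, densely
defined operator the closure is its unique bounded extension to all of `H`. -/
def deformed (U : Iso g →* unitary (H →L[ℂ] H)) (ξ : Fin 2 → VField M) (lam : ℝ)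
    (F : H →L[ℂ] H) : H →ₗ.[ℂ] H :=
  (deformedCore U ξ lam F).closure

/-- The adjoint action `α_h(T) = U(h) T U(h)⁻¹` on operators `T` with domain `D ⊆ H`; the domain
of `α_h(T)` is `U(h) D`. -/
def adjPMap (U : Iso g →* unitary (H →L[ℂ] H)) (h : Iso g) (T : H →ₗ.[ℂ] H) : H →ₗ.[ℂ] H where
  domain := T.domain.comap ((U h⁻¹ : H →L[ℂ] H) : H →ₗ[ℂ] H)
  toFun :=
    { toFun := fun Ψ ↦ (U h : H →L[ℂ] H) (T ⟨(U h⁻¹ : H →L[ℂ] H) Ψ, Ψ.2⟩)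
      map_add' := fun a b ↦ by
        rw [← map_add, ← LinearPMap.map_add]; congr 2; ext; simp
      map_smul' := fun c a ↦ by
        rw [RingHom.id_apply, ← map_smul, ← LinearPMap.map_smul]; congr 2; ext; simp }

end Deformation

end Warped

end

noncomputable section

/-! Existence of the limit. The two flows commute, so `pairFlow g ξ` is a homomorphism from ℝ² to
the isometry group, and the integrand becomes e^{-is·s'} χ(εs, εs') a(s, s') with amplitude a(s, s')
= α_{φ(λQs)}(F) U_ξ(s')Ψ. Both factors of a come from smooth orbit maps of isometric ℝ²-actions; the
derivatives of such maps have constant norm, so all derivatives of a are bounded. Integration by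
parts with -i(∂_d + 1)(ℓ - i)⁻¹, where ℓ is the coordinate conjugate to d, gains decay in every
direction and costs only derivatives. After finitely many repetitions the integral converges
absolutely, and the cutoff contributes an error O(ε) (`tendsto_oscillatory`).

Part a). The flow of h_*ξ is the conjugate by h of the flow of ξ, so the integrand for h_*ξ and
α_h(F) at Ψ is U(h) applied to the integrand for ξ and F at U(h)⁻¹Ψ.

Part b). One has φ_{Nξ,s} = φ_{ξ,Nᵀs}. The substitution (s, s') ↦ (Ns, N⁻ᵀs') preserves s·s' and
Lebesgue measure, and NᵀQN = det N · Q turns λ into det N · λ. Only the cutoff changes, and all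
cutoffs are admitted. The exchange of the two fields is the case of a permutation matrix of
determinant -1.

These identities hold for the operators before closure, domains included. They pass to the closures
because U(h) acts on graphs by a homeomorphism; no norm bound on the deformed operator is needed.

The geometric input is that a vanishing bracket makes flows commute. The derivative at time 0 of the
pull-back of Y along the flow of X is the bracket, computed in a chart; the group law carries this
to all times, and uniqueness of integral curves on a Hausdorff manifold concludes. -/

namespace Warped

/-! ### Uniform symbol classes and oscillatory integrals -/

section Symbols

variable {ι V W G : Type*} [NormedAddCommGroup V] [NormedSpace ℝ V]
  [NormedAddCommGroup W] [NormedSpace ℝ W] [NormedAddCommGroup G]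

/-- A family of smooth functions all of whose derivatives are bounded, uniformly in the family,
by multiples of the weight `m`. -/
def IsUniformSymbol [NormedSpace ℝ G] (b : ι → V → G) (m : V → ℝ) : Prop :=
  (∀ i, ContDiff ℝ ∞ (b i)) ∧
    ∀ n : ℕ, ∃ C : ℝ, ∀ i z, ‖iteratedFDeriv ℝ n (b i) z‖ ≤ C * m z

namespace IsUniformSymbol

section Real

variable [NormedSpace ℝ G] {b c : ι → V → G} {m m' : V → ℝ}

theorem add (hb : IsUniformSymbol b m) (hc : IsUniformSymbol c m) :
    IsUniformSymbol (fun i z ↦ b i z + c i z) m := by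
  refine ⟨fun i ↦ (hb.1 i).add (hc.1 i), fun n ↦ ?_⟩
  obtain ⟨B, hB⟩ := hb.2 n
  obtain ⟨C, hC⟩ := hc.2 n
  refine ⟨B + C, fun i z ↦ ?_⟩
  have e := iteratedFDeriv_add_apply (𝕜 := ℝ) (i := n) (x := z)
    (((hb.1 i).of_le (by exact_mod_cast le_top)).contDiffAt)
    (((hc.1 i).of_le (by exact_mod_cast le_top)).contDiffAt)
  change ‖iteratedFDeriv ℝ n (b i + c i) z‖ ≤ _
  rw [e, add_mul]
  exact (norm_add_le _ _).trans (add_le_add (hB i z) (hC i z))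

/-- Leibniz rule: order n involves only orders k and n - k of the factors, so the weights multiply.
-/
theorem bilinear {E F : Type*} [NormedAddCommGroup E] [NormedSpace ℝ E] [NormedAddCommGroup F]
    [NormedSpace ℝ F] (B : E →L[ℝ] F →L[ℝ] G) {f : ι → V → E} {g : ι → V → F}
    (hf : IsUniformSymbol f m) (hg : IsUniformSymbol g m') :
    IsUniformSymbol (fun i z ↦ B (f i z) (g i z)) (fun z ↦ m z * m' z) := by
  refine ⟨fun i ↦ B.isBoundedBilinearMap.contDiff.comp₂ (hf.1 i) (hg.1 i), fun n ↦ ?_⟩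
  choose C hC using hf.2
  choose D hD using hg.2
  refine ⟨‖B‖ * ∑ k ∈ Finset.range (n + 1), (n.choose k : ℝ) * C k * D (n - k), fun i z ↦ ?_⟩
  refine (B.norm_iteratedFDeriv_le_of_bilinear (hf.1 i) (hg.1 i) z
    (by exact_mod_cast le_top)).trans ?_
  rw [mul_assoc]
  refine mul_le_mul_of_nonneg_left ?_ (norm_nonneg B)
  rw [Finset.sum_mul]
  refine Finset.sum_le_sum fun k _ ↦ ?_
  calc (n.choose k : ℝ) * ‖iteratedFDeriv ℝ k (f i) z‖ * ‖iteratedFDeriv ℝ (n - k) (g i) z‖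
      = (n.choose k : ℝ) * (‖iteratedFDeriv ℝ k (f i) z‖ *
        ‖iteratedFDeriv ℝ (n - k) (g i) z‖) := by ring
    _ ≤ (n.choose k : ℝ) * ((C k * m z) * (D (n - k) * m' z)) := by
      refine mul_le_mul_of_nonneg_left ?_ (by positivity)
      exact mul_le_mul (hC k i z) (hD _ i z) (norm_nonneg _) ((norm_nonneg _).trans (hC k i z))
    _ = _ := by ring

theorem comp_clm {b : ι → W → G} {m : W → ℝ} (hb : IsUniformSymbol b m) (L : V →L[ℝ] W) :
    IsUniformSymbol (fun i z ↦ b i (L z)) (fun z ↦ m (L z)) := by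
  refine ⟨fun i ↦ (hb.1 i).comp L.contDiff, fun n ↦ ?_⟩
  obtain ⟨C, hC⟩ := hb.2 n
  refine ⟨C * ‖L‖ ^ n, fun i z ↦ ?_⟩
  have e := L.iteratedFDeriv_comp_right (hb.1 i) z (i := n) (by exact_mod_cast le_top)
  change ‖iteratedFDeriv ℝ n (b i ∘ L) z‖ ≤ _
  rw [e]
  refine (ContinuousMultilinearMap.norm_compContinuousLinearMap_le _ _).trans ?_
  rw [Finset.prod_const, Finset.card_univ, Fintype.card_fin, mul_right_comm]
  exact mul_le_mul_of_nonneg_right (hC i _) (by positivity)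

theorem fderiv_apply (hb : IsUniformSymbol b m) (d : V) :
    IsUniformSymbol (fun i z ↦ fderiv ℝ (b i) z d) m := by
  have hs : ∀ i, ContDiff ℝ ∞ (fderiv ℝ (b i)) := fun i ↦
    (hb.1 i).fderiv_right (by simp)
  refine ⟨fun i ↦ (hs i).clm_apply contDiff_const, fun n ↦ ?_⟩
  obtain ⟨C, hC⟩ := hb.2 (n + 1)
  refine ⟨‖d‖ * C, fun i z ↦ ?_⟩
  refine (norm_iteratedFDeriv_clm_apply_const (hs i).contDiffAt
    (by exact_mod_cast le_top)).trans ?_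
  rw [norm_iteratedFDeriv_fderiv, mul_assoc]
  exact mul_le_mul_of_nonneg_left (hC i z) (norm_nonneg d)

end Real

variable [NormedSpace ℂ G] {b : ι → V → G} {m m' : V → ℝ}

theorem smul {f : ι → V → ℂ} (hf : IsUniformSymbol f m) (hb : IsUniformSymbol b m') :
    IsUniformSymbol (fun i z ↦ f i z • b i z) (fun z ↦ m z * m' z) :=
  bilinear (ContinuousLinearMap.lsmul ℝ ℂ) hf hb

theorem const_smul (c : ℂ) (hb : IsUniformSymbol b m) :
    IsUniformSymbol (fun i z ↦ c • b i z) m := by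
  refine ⟨fun i ↦ contDiff_const.smul (hb.1 i), fun n ↦ ?_⟩
  obtain ⟨C, hC⟩ := hb.2 n
  refine ⟨‖c‖ * C, fun i z ↦ ?_⟩
  have e := iteratedFDeriv_const_smul_apply (𝕜 := ℝ) (i := n) (x := z) (a := c)
    (((hb.1 i).of_le (by exact_mod_cast le_top)).contDiffAt)
  change ‖iteratedFDeriv ℝ n (c • b i) z‖ ≤ _
  rw [e, norm_smul, mul_assoc]
  exact mul_le_mul_of_nonneg_left (hC i z) (norm_nonneg c)

end IsUniformSymbol

/-- The function `t ↦ (t - i)⁻¹` on the real line. -/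
def resolventFun (t : ℝ) : ℂ := ((t : ℂ) - Complex.I)⁻¹

theorem ofReal_sub_I_ne_zero (t : ℝ) : (t : ℂ) - Complex.I ≠ 0 := by
  intro h
  simpa using congrArg Complex.im h

theorem norm_resolventFun_sq (t : ℝ) : ‖resolventFun t‖ ^ 2 = (1 + t ^ 2)⁻¹ := by
  rw [resolventFun, norm_inv, inv_pow, ← Complex.normSq_eq_norm_sq, Complex.normSq_apply]
  simp; ring

theorem norm_resolventFun_le_one (t : ℝ) : ‖resolventFun t‖ ≤ 1 := by
  have h := norm_resolventFun_sq t
  have h1 : (1 + t ^ 2)⁻¹ ≤ 1 := inv_le_one_of_one_le₀ (by nlinarith [sq_nonneg t])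
  nlinarith [norm_nonneg (resolventFun t)]

theorem hasDerivAt_resolventFun (t : ℝ) :
    HasDerivAt resolventFun (-(resolventFun t) ^ 2) t := by
  have h : HasDerivAt (fun t : ℝ ↦ (t : ℂ) - Complex.I) 1 t :=
    (Complex.ofRealCLM.hasDerivAt (x := t)).sub_const _
  refine (h.inv (ofReal_sub_I_ne_zero t)).congr_deriv ?_
  rw [resolventFun, inv_pow, neg_div, one_div]

theorem contDiff_resolventFun : ContDiff ℝ ∞ resolventFun :=
  (Complex.ofRealCLM.contDiff.sub contDiff_const).inv ofReal_sub_I_ne_zero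

theorem iteratedDeriv_resolventFun (n : ℕ) :
    iteratedDeriv n resolventFun
      = fun t ↦ ((-1) ^ n * (n.factorial : ℂ)) * resolventFun t ^ (n + 1) := by
  induction n with
  | zero => ext t; simp
  | succ n ih =>
    ext t
    rw [iteratedDeriv_succ, ih]
    have h := ((hasDerivAt_resolventFun t).pow (n + 1)).const_mul
      ((-1) ^ n * (n.factorial : ℂ))
    rw [show deriv (fun t ↦ ((-1) ^ n * (n.factorial : ℂ)) * resolventFun t ^ (n + 1)) t = _
      from h.deriv]
    rw [Nat.factorial_succ, Nat.add_sub_cancel]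
    push_cast
    ring

/-- The n-th derivative is a multiple of the (n+1)-st power of a function bounded by 1, hence is
dominated by its first power. Differentiation therefore loses none of the decay. -/
theorem isUniformSymbol_resolventFun :
    IsUniformSymbol (fun _ : ι ↦ resolventFun) (fun t ↦ ‖resolventFun t‖) := by
  refine ⟨fun _ ↦ contDiff_resolventFun, fun n ↦ ⟨n.factorial, fun _ t ↦ ?_⟩⟩
  rw [norm_iteratedFDeriv_eq_norm_iteratedDeriv, iteratedDeriv_resolventFun]
  simp only [norm_mul, norm_pow, norm_neg, norm_one, one_pow, one_mul, Complex.norm_natCast]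
  refine mul_le_mul_of_nonneg_left ?_ (by positivity)
  rw [pow_succ]
  exact mul_le_of_le_one_left (norm_nonneg _)
    (pow_le_one₀ (norm_nonneg _) (norm_resolventFun_le_one t))

/-- The transposed operator `b ↦ -i (∂_d + 1) ((ℓ - i)⁻¹ b)`: if `∂_d e = -i ℓ e`, it can be
introduced into an oscillatory integral with phase factor `e`, where it produces a factor of
decay in the direction of `ℓ`. -/
def partsOp [NormedSpace ℂ G] (p : V × (V →L[ℝ] ℝ)) (b : V → G) : V → G := fun z ↦
  (-Complex.I) • (fderiv ℝ (fun z ↦ resolventFun (p.2 z) • b z) z p.1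
    + resolventFun (p.2 z) • b z)

/-- The iteration of `partsOp` along a list of pairs. -/
def partsOps [NormedSpace ℂ G] (l : List (V × (V →L[ℝ] ℝ))) (b : V → G) : V → G :=
  l.foldr partsOp b

/-- The weight produced by `partsOps`. -/
def partsWeight (l : List (V × (V →L[ℝ] ℝ))) (z : V) : ℝ :=
  (l.map fun p ↦ ‖resolventFun (p.2 z)‖).prod

section

variable [NormedSpace ℂ G] {b c : V → G}

/-- One integration by parts costs one derivative, of which a symbol has infinitely many, and
improves the weight by |ℓ - i|⁻¹. -/
theorem IsUniformSymbol.partsOp {b : ι → V → G} {m : V → ℝ} (hb : IsUniformSymbol b m)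
    (p : V × (V →L[ℝ] ℝ)) :
    IsUniformSymbol (fun i ↦ partsOp p (b i)) (fun z ↦ ‖resolventFun (p.2 z)‖ * m z) := by
  have h := ((isUniformSymbol_resolventFun (ι := ι)).comp_clm p.2).smul hb
  exact ((h.fderiv_apply p.1).add h).const_smul _

theorem IsUniformSymbol.partsOps {b : ι → V → G} {m : V → ℝ} (hb : IsUniformSymbol b m)
    (l : List (V × (V →L[ℝ] ℝ))) :
    IsUniformSymbol (fun i ↦ partsOps l (b i)) (fun z ↦ partsWeight l z * m z) := by
  induction l with
  | nil => simpa [Warped.partsOps, partsWeight] using hb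
  | cons p l ih =>
    have := ih.partsOp p
    simpa [Warped.partsOps, partsWeight, mul_assoc] using this

theorem contDiff_resolventFun_smul (hb : ContDiff ℝ ∞ b) (ℓ : V →L[ℝ] ℝ) :
    ContDiff ℝ ∞ (fun z ↦ resolventFun (ℓ z) • b z) :=
  (contDiff_resolventFun.comp ℓ.contDiff).smul hb

theorem contDiff_partsOp (hb : ContDiff ℝ ∞ b) (p : V × (V →L[ℝ] ℝ)) :
    ContDiff ℝ ∞ (partsOp p b) := by
  have h := contDiff_resolventFun_smul hb p.2
  exact contDiff_const.smul
    (((h.fderiv_right (m := ∞) (by simp)).clm_apply contDiff_const).add h)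

theorem contDiff_partsOps (hb : ContDiff ℝ ∞ b) (l : List (V × (V →L[ℝ] ℝ))) :
    ContDiff ℝ ∞ (partsOps l b) := by
  induction l with
  | nil => exact hb
  | cons p l ih => exact contDiff_partsOp ih p

/-- Linearity is needed to separate the limit from the cutoff error in a + ε(c_ε a). -/
theorem partsOp_add_smul (hb : ContDiff ℝ ∞ b) (hc : ContDiff ℝ ∞ c) (r : ℂ)
    (p : V × (V →L[ℝ] ℝ)) :
    partsOp p (fun z ↦ b z + r • c z) = fun z ↦ partsOp p b z + r • partsOp p c z := by
  ext z
  have h1 := ((contDiff_resolventFun_smul hb p.2).differentiable (by simp)) z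
  have h2 := ((contDiff_resolventFun_smul hc p.2).differentiable (by simp)) z
  have e : (fun z ↦ resolventFun (p.2 z) • (b z + r • c z))
      = fun z ↦ resolventFun (p.2 z) • b z + r • (resolventFun (p.2 z) • c z) := by
    ext z; rw [smul_add, smul_comm]
  have h3 := (h1.hasFDerivAt.add (h2.hasFDerivAt.const_smul r)).fderiv
  simp only [partsOp]
  rw [e, show fderiv ℝ (fun z ↦ resolventFun (p.2 z) • b z + r • (resolventFun (p.2 z) • c z)) z
    = _ from h3]
  simp only [add_apply, smul_apply, smul_add,
    smul_comm r (-Complex.I), smul_comm r (resolventFun (p.2 z))]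
  abel

theorem partsOps_add_smul (hb : ContDiff ℝ ∞ b) (hc : ContDiff ℝ ∞ c) (r : ℂ)
    (l : List (V × (V →L[ℝ] ℝ))) :
    partsOps l (fun z ↦ b z + r • c z) = fun z ↦ partsOps l b z + r • partsOps l c z := by
  induction l with
  | nil => rfl
  | cons p l ih =>
    change partsOp p (partsOps l _) = fun z ↦ partsOp p (partsOps l b) z
      + r • partsOp p (partsOps l c) z
    rw [ih, partsOp_add_smul (contDiff_partsOps hb l) (contDiff_partsOps hc l)]

theorem hasCompactSupport_partsOp (hb : HasCompactSupport b) (p : V × (V →L[ℝ] ℝ)) :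
    HasCompactSupport (partsOp p b) := by
  have h : HasCompactSupport (fun z ↦ resolventFun (p.2 z) • b z) := hb.smul_left
  have h' := (h.fderiv_apply ℝ p.1).add h
  exact h'.smul_left (f := fun _ ↦ -Complex.I)

theorem hasCompactSupport_partsOps (hb : HasCompactSupport b) (l : List (V × (V →L[ℝ] ℝ))) :
    HasCompactSupport (partsOps l b) := by
  induction l with
  | nil => exact hb
  | cons p l ih => exact hasCompactSupport_partsOp ih p

variable [FiniteDimensional ℝ V] [MeasurableSpace V] [BorelSpace V] {μ : Measure V}
  [μ.IsAddHaarMeasure] {e : V → ℂ}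

/-- With u = (ℓ - i)⁻¹b, moving ∂_d onto e gives -i∫(e - ∂_d e)u = ∫ -i(1 + iℓ)e u = ∫(ℓ - i)e u = ∫
e b. Compact support removes the boundary terms. -/
theorem integral_smul_partsOp (he : ContDiff ℝ ∞ e) (hb : ContDiff ℝ ∞ b)
    (hbs : HasCompactSupport b) {p : V × (V →L[ℝ] ℝ)}
    (hp : ∀ z, fderiv ℝ e z p.1 = -Complex.I * (p.2 z : ℂ) * e z) :
    ∫ z, e z • partsOp p b z ∂μ = ∫ z, e z • b z ∂μ := by
  set u : V → G := fun z ↦ resolventFun (p.2 z) • b z with hu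
  have hus : ContDiff ℝ ∞ u := contDiff_resolventFun_smul hb p.2
  have huc : HasCompactSupport u := hbs.smul_left
  have hdu : ContDiff ℝ ∞ (fun z ↦ fderiv ℝ u z p.1) :=
    (hus.fderiv_right (m := ∞) (by simp)).clm_apply contDiff_const
  have hde : ContDiff ℝ ∞ (fun z ↦ fderiv ℝ e z p.1) :=
    (he.fderiv_right (m := ∞) (by simp)).clm_apply contDiff_const
  have i1 : Integrable (fun z ↦ e z • fderiv ℝ u z p.1) μ :=
    (he.continuous.smul hdu.continuous).integrable_of_hasCompactSupport
      ((huc.fderiv_apply ℝ p.1).smul_left)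
  have i2 : Integrable (fun z ↦ fderiv ℝ e z p.1 • u z) μ :=
    (hde.continuous.smul hus.continuous).integrable_of_hasCompactSupport huc.smul_left
  have i3 : Integrable (fun z ↦ e z • u z) μ :=
    (he.continuous.smul hus.continuous).integrable_of_hasCompactSupport huc.smul_left
  have key := integral_bilinear_fderiv_right_eq_neg_left_of_integrable
    (B := ContinuousLinearMap.lsmul ℝ ℂ) (μ := μ) (v := p.1) (f := e) (g := u)
    i2 i1 i3 (fun z _ ↦ he.differentiable (by simp) z)
    (fun z _ ↦ hus.differentiable (by simp) z)
  simp only [ContinuousLinearMap.lsmul_apply] at key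
  have e1 : (fun z ↦ e z • partsOp p b z)
      = fun z ↦ (-Complex.I) • (e z • fderiv ℝ u z p.1 + e z • u z) := by
    ext z
    simp only [partsOp, ← hu]
    rw [smul_comm, smul_add]
  have e2 : (fun z ↦ e z • b z)
      = fun z ↦ (-Complex.I) • (-(fderiv ℝ e z p.1 • u z) + e z • u z) := by
    ext z
    rw [hp, hu]
    simp only [← neg_smul, ← add_smul, smul_smul]
    congr 1
    have := ofReal_sub_I_ne_zero (p.2 z)
    simp only [resolventFun]
    field_simp
    ring_nf
    simp only [Complex.I_sq]
    ring
  rw [e1, e2, integral_smul, integral_smul, integral_add i1 i3,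
    show ∫ z, -(fderiv ℝ e z p.1 • u z) + e z • u z ∂μ = _ from integral_add i2.neg i3, key]
  rw [← integral_neg]

theorem integral_smul_partsOps (he : ContDiff ℝ ∞ e) (hb : ContDiff ℝ ∞ b)
    (hbs : HasCompactSupport b) {l : List (V × (V →L[ℝ] ℝ))}
    (hl : ∀ p ∈ l, ∀ z, fderiv ℝ e z p.1 = -Complex.I * (p.2 z : ℂ) * e z) :
    ∫ z, e z • partsOps l b z ∂μ = ∫ z, e z • b z ∂μ := by
  induction l with
  | nil => rfl
  | cons p l ih =>
    rw [← ih fun q hq ↦ hl q (List.mem_cons_of_mem _ hq)]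
    exact integral_smul_partsOp he (contDiff_partsOps hb l) (hasCompactSupport_partsOps hbs l)
      (hl p List.mem_cons_self)

end

/-- Rescaled cutoffs converge to `1` at first order, in the symbol class of weight `1 + ‖z‖`. -/
theorem isUniformSymbol_cutoff {χ : V → ℂ} (hχ : ContDiff ℝ ∞ χ) (hc : HasCompactSupport χ)
    (h0 : χ 0 = 1) :
    IsUniformSymbol (fun (ε : Set.Ioc (0 : ℝ) 1) (z : V) ↦
      ((ε : ℝ)⁻¹ : ℂ) • (χ ((ε : ℝ) • z) - 1)) (fun z ↦ 1 + ‖z‖) := by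
  have hs : ∀ ε : ℝ, ContDiff ℝ ∞ (fun z : V ↦ χ (ε • z)) := fun ε ↦
    hχ.comp (contDiff_const.smul contDiff_id)
  have hs' : ∀ ε : ℝ, ContDiff ℝ ∞ (fun z : V ↦ χ (ε • z) - 1) := fun ε ↦
    (hs ε).sub contDiff_const
  refine ⟨fun ε ↦ (contDiff_const (c := ((ε : ℝ)⁻¹ : ℂ))).smul (hs' (ε : ℝ)), fun n ↦ ?_⟩
  have hsm : ∀ (ε : Set.Ioc (0 : ℝ) 1) (z : V), iteratedFDeriv ℝ n (fun z : V ↦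
      ((ε : ℝ)⁻¹ : ℂ) • (χ ((ε : ℝ) • z) - 1)) z
      = ((ε : ℝ)⁻¹ : ℂ) • iteratedFDeriv ℝ n (fun z : V ↦ χ ((ε : ℝ) • z) - 1) z := fun ε z ↦
    iteratedFDeriv_const_smul_apply (𝕜 := ℝ) (i := n) (x := z) (a := ((ε : ℝ)⁻¹ : ℂ))
      (((hs' ε).of_le (by exact_mod_cast le_top)).contDiffAt)
  have hn : ∀ ε : Set.Ioc (0 : ℝ) 1, ‖((ε : ℝ)⁻¹ : ℂ)‖ = (ε : ℝ)⁻¹ := fun ε ↦ by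
    rw [norm_inv, Complex.norm_real, Real.norm_of_nonneg ε.2.1.le]
  rcases n with _ | n
  -- Order 0: by the Lipschitz bound |χ(εz) - χ(0)| ≤ Cε‖z‖, which is where the growth of the weight
  -- comes from.
  · obtain ⟨C, hC⟩ := ContDiff.lipschitzWith_of_hasCompactSupport hc hχ (by simp)
    refine ⟨C, fun ε z ↦ ?_⟩
    rw [norm_iteratedFDeriv_zero, norm_smul, hn, inv_mul_le_iff₀ ε.2.1]
    have h := hC.dist_le_mul ((ε : ℝ) • z) 0
    rw [h0, dist_zero_right, norm_smul, Real.norm_of_nonneg ε.2.1.le, dist_eq_norm] at h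
    refine h.trans ?_
    have : 0 ≤ (ε : ℝ) * C := mul_nonneg ε.2.1.le C.2
    nlinarith
  -- Positive order: the chain rule yields ε^(n+1), and one factor ε cancels ε⁻¹; the others are at
  -- most 1.
  · obtain ⟨C, hC⟩ := (hχ.continuous_iteratedFDeriv (m := n + 1)
      (by exact_mod_cast le_top)).bounded_above_of_compact_support (hc.iteratedFDeriv (n + 1))
    refine ⟨C, fun ε z ↦ ?_⟩
    have hC0 : 0 ≤ C := (norm_nonneg _).trans (hC 0)
    rw [hsm, norm_smul, hn, inv_mul_le_iff₀ ε.2.1]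
    have e1 : iteratedFDeriv ℝ (n + 1) (fun z : V ↦ χ ((ε : ℝ) • z) - 1) z
        = iteratedFDeriv ℝ (n + 1) (fun z : V ↦ χ ((ε : ℝ) • z)) z := by
      have := iteratedFDeriv_sub_apply (𝕜 := ℝ) (i := n + 1) (x := z)
        (((hs ε).of_le (by exact_mod_cast le_top)).contDiffAt)
        (contDiffAt_const (c := (1 : ℂ)))
      rw [iteratedFDeriv_const_of_ne (by omega)] at this
      rw [Pi.zero_apply, sub_zero] at this
      exact this
    have e2 := iteratedFDeriv_comp_const_smul (𝕜 := ℝ) (i := n + 1) (f := χ) (ε : ℝ)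
      (hχ.of_le (by exact_mod_cast le_top))
    rw [e1]
    rw [show iteratedFDeriv ℝ (n + 1) (fun z : V ↦ χ ((ε : ℝ) • z)) z = _ from congrFun e2 z,
      norm_smul, norm_pow, Real.norm_of_nonneg ε.2.1.le]
    calc (ε : ℝ) ^ (n + 1) * ‖iteratedFDeriv ℝ (n + 1) χ ((ε : ℝ) • z)‖
        ≤ ε * C := mul_le_mul (pow_le_of_le_one ε.2.1.le ε.2.2 (by omega)) (hC _)
          (norm_nonneg _) ε.2.1.le
      _ ≤ ε * (C * (1 + ‖z‖)) := by
        refine mul_le_mul_of_nonneg_left ?_ ε.2.1.le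
        nlinarith [norm_nonneg z]

/-- Convergence of oscillatory integrals: if integrating by parts along `l` produces enough
decay, the regularized integrals of a symbol of weight `1` converge to a limit which does not
depend on the regularization. -/
theorem tendsto_oscillatory [NormedSpace ℂ G] [FiniteDimensional ℝ V] [MeasurableSpace V]
    [BorelSpace V] {μ : Measure V} [μ.IsAddHaarMeasure] {e : V → ℂ} {a : V → G}
    (he : ContDiff ℝ ∞ e) (he1 : ∀ z, ‖e z‖ ≤ 1) {l : List (V × (V →L[ℝ] ℝ))}
    (hl : ∀ p ∈ l, ∀ z, fderiv ℝ e z p.1 = -Complex.I * (p.2 z : ℂ) * e z)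
    (hw : Integrable (fun z ↦ partsWeight l z * (1 + ‖z‖)) μ)
    (ha : IsUniformSymbol (fun _ : Unit ↦ a) (fun _ ↦ 1))
    {χ : V → ℂ} (hχ : ContDiff ℝ ∞ χ) (hc : HasCompactSupport χ) (h0 : χ 0 = 1) :
    Filter.Tendsto (fun ε : ℝ ↦ ∫ z, e z • (χ (ε • z) • a z) ∂μ) (𝓝[>] 0)
      (𝓝 (∫ z, e z • partsOps l a z ∂μ)) := by
  have ha0 : ContDiff ℝ ∞ a := ha.1 ()
  have hwn : ∀ z, 0 ≤ partsWeight l z := fun z ↦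
    List.prod_nonneg fun x hx ↦ by
      obtain ⟨p, _, rfl⟩ := List.mem_map.1 hx
      exact norm_nonneg _
  set c : Set.Ioc (0 : ℝ) 1 → V → ℂ := fun ε z ↦ ((ε : ℝ)⁻¹ : ℂ) • (χ ((ε : ℝ) • z) - 1)
  have hcs : IsUniformSymbol c (fun z ↦ 1 + ‖z‖) := isUniformSymbol_cutoff hχ hc h0
  have ha' : IsUniformSymbol (fun _ : Set.Ioc (0 : ℝ) 1 ↦ a) (fun _ ↦ 1) :=
    ⟨fun _ ↦ ha0, fun n ↦ (ha.2 n).imp fun C hC _ z ↦ hC () z⟩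
  obtain ⟨A, hA⟩ := (ha.partsOps l).2 0
  obtain ⟨C, hC⟩ := ((hcs.smul ha').partsOps l).2 0
  simp only [norm_iteratedFDeriv_zero, mul_one] at hA hC
  have sca : ∀ ε, ContDiff ℝ ∞ (fun z ↦ c ε z • a z) := fun ε ↦ (hcs.1 ε).smul ha0
  have sTa := contDiff_partsOps ha0 l
  have sTc := fun ε ↦ contDiff_partsOps (sca ε) l
  have iTa : Integrable (fun z ↦ e z • partsOps l a z) μ := by
    refine (hw.const_mul |A|).mono' (he.continuous.smul sTa.continuous).aestronglyMeasurable
      (Filter.Eventually.of_forall fun z ↦ ?_)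
    rw [norm_smul]
    refine (mul_le_of_le_one_left (norm_nonneg _) (he1 z)).trans ((hA () z).trans ?_)
    refine mul_le_mul (le_abs_self A) ?_ (hwn z) (abs_nonneg A)
    nlinarith [hwn z, norm_nonneg z]
  have bTc : ∀ ε z, ‖e z • partsOps l (fun z ↦ c ε z • a z) z‖
      ≤ C * (partsWeight l z * (1 + ‖z‖)) := fun ε z ↦ by
    rw [norm_smul]
    exact (mul_le_of_le_one_left (norm_nonneg _) (he1 z)).trans (hC ε z)
  have iTc : ∀ ε, Integrable (fun z ↦ e z • partsOps l (fun z ↦ c ε z • a z) z) μ := fun ε ↦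
    (hw.const_mul C).mono' (he.continuous.smul (sTc ε).continuous).aestronglyMeasurable
      (Filter.Eventually.of_forall (bTc ε))
  -- Integration by parts is applied to the compactly supported product, and only afterwards is
  -- χ(εz)a split as a + ε(c_ε a). Each summand is then integrable, the second one with a bound
  -- uniform in ε.
  have main : ∀ ε : Set.Ioc (0 : ℝ) 1, ∫ z, e z • (χ ((ε : ℝ) • z) • a z) ∂μ
      = (∫ z, e z • partsOps l a z ∂μ)
        + (ε : ℂ) • ∫ z, e z • partsOps l (fun z ↦ c ε z • a z) z ∂μ := fun ε ↦ by
    have hne : ((ε : ℝ) : ℂ) ≠ 0 := by exact_mod_cast ε.2.1.ne'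
    have e1 : (fun z ↦ χ ((ε : ℝ) • z) • a z) = fun z ↦ a z + (ε : ℂ) • (c ε z • a z) := by
      ext z
      simp only [c, smul_smul]
      rw [mul_smul, smul_smul, smul_eq_mul]
      rw [mul_inv_cancel_left₀ hne, sub_smul, one_smul]
      abel
    have hsup : HasCompactSupport (fun z ↦ χ ((ε : ℝ) • z) • a z) :=
      (hc.comp_smul ε.2.1.ne').smul_right
    have hsm : ContDiff ℝ ∞ (fun z ↦ χ ((ε : ℝ) • z) • a z) :=
      (hχ.comp (contDiff_const.smul contDiff_id)).smul ha0
    rw [← integral_smul_partsOps he hsm hsup hl, e1, partsOps_add_smul ha0 (sca ε),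
      ← integral_smul]
    refine Eq.trans ?_ (integral_add iTa ((iTc ε).smul (ε : ℂ)))
    refine integral_congr_ae (Filter.Eventually.of_forall fun z ↦ ?_)
    simp only
    rw [smul_add, smul_comm]
  have hlim : Filter.Tendsto (fun ε : ℝ ↦ ε * (C * ∫ z, partsWeight l z * (1 + ‖z‖) ∂μ))
      (𝓝[>] 0) (𝓝 0) := by
    have : Filter.Tendsto (fun ε : ℝ ↦ ε * (C * ∫ z, partsWeight l z * (1 + ‖z‖) ∂μ))
      (𝓝 0) (𝓝 (0 * (C * ∫ z, partsWeight l z * (1 + ‖z‖) ∂μ))) :=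
      Filter.tendsto_id.mul_const _
    rw [zero_mul] at this
    exact this.mono_left nhdsWithin_le_nhds
  rw [tendsto_iff_norm_sub_tendsto_zero]
  refine squeeze_zero' (Filter.Eventually.of_forall fun _ ↦ norm_nonneg _) ?_ hlim
  filter_upwards [Ioc_mem_nhdsGT (zero_lt_one' ℝ)] with ε hε
  rw [main ⟨ε, hε⟩, add_sub_cancel_left, norm_smul, Complex.norm_real,
    Real.norm_of_nonneg hε.1.le]
  refine mul_le_mul_of_nonneg_left ?_ hε.1.le
  rw [← integral_const_mul]
  exact norm_integral_le_of_norm_le (hw.const_mul C)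
    (Filter.Eventually.of_forall (bTc ⟨ε, hε⟩))

end Symbols

/-! ### Commuting flows -/

section LocalFlow

variable {E : Type*} [NormedAddCommGroup E] [NormedSpace ℝ E]

/-- The derivative at `0` of the pull-back of a vector field along a local flow is the Lie
bracket. -/
theorem hasDerivAt_pullback_localFlow {Φ : ℝ × E → E} {X Y : E → E} {x₀ : E}
    (hΦ : ContDiffAt ℝ 2 Φ (0, x₀)) (h0 : ∀ᶠ x in 𝓝 x₀, Φ (0, x) = x)
    (hX : ∀ᶠ x in 𝓝 x₀, fderiv ℝ Φ (0, x) (1, 0) = X x) (hY : DifferentiableAt ℝ Y x₀) :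
    HasDerivAt (fun s : ℝ ↦ fderiv ℝ (fun x ↦ Φ (-s, x)) (Φ (s, x₀)) (Y (Φ (s, x₀))))
      (fderiv ℝ Y x₀ (X x₀) - fderiv ℝ X x₀ (Y x₀)) 0 := by
  have hΦ0 : Φ (0, x₀) = x₀ := h0.self_of_nhds
  have hev : ∀ᶠ z in 𝓝 ((0 : ℝ), x₀), DifferentiableAt ℝ Φ z :=
    (hΦ.eventually (by simp)).mono fun z hz ↦ hz.differentiableAt (by simp)
  have hinr : Filter.Tendsto (fun x : E ↦ ((0 : ℝ), x)) (𝓝 x₀) (𝓝 (0, x₀)) :=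
    (by fun_prop : Continuous fun x : E ↦ ((0 : ℝ), x)).tendsto _
  have hD : DifferentiableAt ℝ (fderiv ℝ Φ) (0, x₀) :=
    (hΦ.fderiv_right (m := 1) (by norm_num)).differentiableAt (by simp)
  set D' := fderiv ℝ (fderiv ℝ Φ) (0, x₀) with hD'
  have hsymm : ∀ v w, D' v w = D' w v := fun v w ↦
    (hΦ.isSymmSndFDerivAt (by simp)) v w
  have hinr' : ∀ x : E, HasFDerivAt (fun x : E ↦ ((0 : ℝ), x)) (ContinuousLinearMap.inr ℝ ℝ E) x :=
    fun x ↦ hasFDerivAt_prodMk_right _ _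
  -- the partial derivative in `x` along `r = 0`
  have hx : ∀ᶠ x in 𝓝 x₀, ∀ v, fderiv ℝ Φ (0, x) (0, v) = v := by
    filter_upwards [hinr.eventually hev, h0.eventually_nhds] with x hx h0x v
    have h1 : HasFDerivAt (fun x ↦ Φ (0, x)) ((fderiv ℝ Φ (0, x)).comp
      (ContinuousLinearMap.inr ℝ ℝ E)) x := hx.hasFDerivAt.comp x (hinr' x)
    have h2 : HasFDerivAt (fun x ↦ Φ (0, x)) (ContinuousLinearMap.id ℝ E) x :=
      (hasFDerivAt_id x).congr_of_eventuallyEq h0x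
    exact DFunLike.congr_fun (h1.unique h2) v
  have hDx : HasFDerivAt (fun x : E ↦ fderiv ℝ Φ (0, x))
      (D'.comp (ContinuousLinearMap.inr ℝ ℝ E)) x₀ :=
    hD.hasFDerivAt.comp x₀ (hinr' x₀)
  -- Near x₀ the map Φ(0, ·) is the identity, so its second derivative in x vanishes.
  have hxx : ∀ v w : E, D' (0, w) (0, v) = 0 := fun v w ↦ by
    have h1 := hDx.clm_apply (hasFDerivAt_const ((0 : ℝ), v) x₀)
    have h2 : HasFDerivAt (fun x : E ↦ fderiv ℝ Φ (0, x) (0, v)) (0 : E →L[ℝ] E) x₀ :=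
      (hasFDerivAt_const v x₀).congr_of_eventuallyEq (hx.mono fun x hx ↦ hx v)
    simpa using DFunLike.congr_fun (h1.unique h2) w
  -- The time derivative of Φ at time 0 is X, so the mixed derivative is that of X. The symmetry of
  -- `D'` then produces the term -DX(Y) of the bracket.
  have hsx : ∀ v : E, D' (0, v) (1, 0) = fderiv ℝ X x₀ v := fun v ↦ by
    have h1 := hDx.clm_apply (hasFDerivAt_const ((1 : ℝ), (0 : E)) x₀)
    have h2 := h1.congr_of_eventuallyEq (hX.mono fun x hx ↦ hx.symm)
    simp [h2.fderiv]
  have hΦs : HasDerivAt (fun s : ℝ ↦ Φ (s, x₀)) (X x₀) 0 := by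
    have h1 : HasDerivAt (fun s : ℝ ↦ (s, x₀)) ((1 : ℝ), (0 : E)) 0 :=
      (hasDerivAt_id _).prodMk (hasDerivAt_const _ _)
    have h2 := hev.self_of_nhds.hasFDerivAt.comp_hasDerivAt (0 : ℝ) h1
    rwa [hX.self_of_nhds] at h2
  have hc : HasDerivAt (fun s : ℝ ↦ (-s, Φ (s, x₀))) ((-1 : ℝ), X x₀) 0 :=
    (hasDerivAt_id _).neg.prodMk hΦs
  have hc0 : (fun s : ℝ ↦ (-s, Φ (s, x₀))) 0 = (0, x₀) := by simp [hΦ0]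
  have h1 : HasDerivAt (fun s : ℝ ↦ fderiv ℝ Φ (-s, Φ (s, x₀))) (D' (-1, X x₀)) 0 :=
    HasFDerivAt.comp_hasDerivAt (0 : ℝ)
      (by rw [neg_zero, hΦ0]; exact hD.hasFDerivAt) hc
  have h2 : HasDerivAt (fun s : ℝ ↦ Y (Φ (s, x₀))) (fderiv ℝ Y x₀ (X x₀)) 0 :=
    HasFDerivAt.comp_hasDerivAt (0 : ℝ) (by rw [hΦ0]; exact hY.hasFDerivAt) hΦs
  have h3 : HasDerivAt (fun s : ℝ ↦ ((0 : ℝ), Y (Φ (s, x₀)))) (0, fderiv ℝ Y x₀ (X x₀)) 0 :=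
    (hasDerivAt_const _ _).prodMk h2
  have h4 := h1.clm_apply h3
  have hval : D' (-1, X x₀) (0, Y (Φ (0, x₀))) + fderiv ℝ Φ (-0, Φ (0, x₀)) (0,
      fderiv ℝ Y x₀ (X x₀)) = fderiv ℝ Y x₀ (X x₀) - fderiv ℝ X x₀ (Y x₀) := by
    have e : ((-1 : ℝ), X x₀) = -((1 : ℝ), (0 : E)) + (0, X x₀) := by simp
    rw [hΦ0, neg_zero, hx.self_of_nhds, e, map_add, map_neg, add_apply,
      hxx, neg_apply, hsymm, hsx]
    abel
  rw [hval] at h4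
  refine h4.congr_of_eventuallyEq ?_
  have hct : Filter.Tendsto (fun s : ℝ ↦ (-s, Φ (s, x₀))) (𝓝 0) (𝓝 (0, x₀)) := by
    have := hc.continuousAt.tendsto
    simpa only [hc0] using this
  filter_upwards [hct.eventually hev] with s hs
  have h5 : HasFDerivAt (fun x ↦ Φ (-s, x)) ((fderiv ℝ Φ (-s, Φ (s, x₀))).comp
      (ContinuousLinearMap.inr ℝ ℝ E)) (Φ (s, x₀)) :=
    hs.hasFDerivAt.comp _ (hasFDerivAt_prodMk_right _ _)
  rw [h5.fderiv]
  rfl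

end LocalFlow

/-! ### From local flows to flows on the manifold -/

section Flow

variable {M : Type*} [TopologicalSpace M] [ChartedSpace (EuclideanSpace ℝ (Fin 4)) M]

/-- The model space of the tangent spaces. -/
abbrev E4 := EuclideanSpace ℝ (Fin 4)

/-- The derivative of a self-map of `M`, as a linear map of the model space. -/
def tangentMapAt (h : M → M) (p : M) : E4 →L[ℝ] E4 := mfderiv (𝓡 4) (𝓡 4) h p

theorem tangentMapAt_id (p : M) : tangentMapAt (fun x : M ↦ x) p = ContinuousLinearMap.id ℝ E4 :=
  mfderiv_id

theorem tangentMapAt_comp {f h : M → M} (hf : ContMDiff (𝓡 4) (𝓡 4) ∞ f)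
    (hh : ContMDiff (𝓡 4) (𝓡 4) ∞ h) (p : M) :
    tangentMapAt (fun x ↦ f (h x)) p = (tangentMapAt f (h p)).comp (tangentMapAt h p) :=
  mfderiv_comp p (hf.mdifferentiable (by simp) _) (hh.mdifferentiable (by simp) _)

variable [IsManifold (𝓡 4) ∞ M] {X Y : VField M} {φ ψ : ℝ → M → M}

namespace IsFlow

theorem contMDiff_apply (hφ : IsFlow X φ) (t : ℝ) : ContMDiff (𝓡 4) (𝓡 4) ∞ (φ t) :=
  hφ.contMDiff.comp (contMDiff_const.prodMk contMDiff_id)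

theorem neg_apply_apply (hφ : IsFlow X φ) (t : ℝ) (p : M) : φ (-t) (φ t p) = p := by
  rw [← hφ.add, neg_add_cancel, hφ.zero]

theorem apply_neg_apply (hφ : IsFlow X φ) (t : ℝ) (p : M) : φ t (φ (-t) p) = p := by
  rw [← hφ.add, add_neg_cancel, hφ.zero]

theorem continuous_curve (hφ : IsFlow X φ) (p : M) : Continuous fun t ↦ φ t p :=
  (hφ.contMDiff.comp (contMDiff_id.prodMk contMDiff_const)).continuous

end IsFlow

/-- The pull-back of a field along the inverse chart is defined by an inverted derivative; this
brings it to the usual coordinate form. -/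
theorem inverse_mfderivWithin_extChartAt_symm {q : M} {x : E4}
    (hx : x ∈ (extChartAt (𝓡 4) q).target) :
    (mfderivWithin 𝓘(ℝ, E4) (𝓡 4) (extChartAt (𝓡 4) q).symm (Set.range (𝓡 4)) x).inverse
      = mfderiv (𝓡 4) 𝓘(ℝ, E4) (extChartAt (𝓡 4) q) ((extChartAt (𝓡 4) q).symm x) :=
  ContinuousLinearMap.inverse_eq (mfderivWithin_extChartAt_symm_comp_mfderiv_extChartAt hx)
    (mfderiv_extChartAt_comp_mfderivWithin_extChartAt_symm hx)

/-- If the Lie bracket of `X` and `Y` vanishes at `q`, so does the derivative at `0` of the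
pull-back of `Y` along the flow of `X`. -/
theorem IsFlow.hasDerivAt_pullback (hφ : IsFlow X φ)
    (hY : ContMDiff (𝓡 4) (𝓡 4).tangent ∞ (fun p ↦ (⟨p, Y p⟩ : TangentBundle (𝓡 4) M))) {q : M}
    (hXY : VectorField.mlieBracket (𝓡 4) X Y q = 0) :
    HasDerivAt (fun s : ℝ ↦ tangentMapAt (φ (-s)) (φ s q) (Y (φ s q))) (0 : E4) 0 := by
  set e := extChartAt (𝓡 4) q with he
  set x₀ : E4 := e q with hx₀
  have hqs : q ∈ e.source := mem_extChartAt_source q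
  have hqt : x₀ ∈ e.target := mem_extChartAt_target q
  have htgt : e.target ∈ 𝓝 x₀ := extChartAt_target_mem_nhds q
  have hsrc : e.source ∈ 𝓝 q := extChartAt_source_mem_nhds q
  have hq : e.symm x₀ = q := e.left_inv hqs
  set Φ : ℝ × E4 → E4 := fun z ↦ e (φ z.1 (e.symm z.2)) with hΦdef
  set Xe : E4 → E4 := VectorField.mpullbackWithin 𝓘(ℝ, E4) (𝓡 4) e.symm X (Set.range (𝓡 4))
  set Ye : E4 → E4 := VectorField.mpullbackWithin 𝓘(ℝ, E4) (𝓡 4) e.symm Y (Set.range (𝓡 4))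
  have hXe : ∀ x ∈ e.target, Xe x = mfderiv (𝓡 4) 𝓘(ℝ, E4) e (e.symm x) (X (e.symm x)) :=
    fun x hx ↦ DFunLike.congr_fun (inverse_mfderivWithin_extChartAt_symm hx) _
  have hYe : ∀ x ∈ e.target, Ye x = mfderiv (𝓡 4) 𝓘(ℝ, E4) e (e.symm x) (Y (e.symm x)) :=
    fun x hx ↦ DFunLike.congr_fun (inverse_mfderivWithin_extChartAt_symm hx) _
  have hΦ : ContDiffAt ℝ 2 Φ (0, x₀) := by
    have h1 : ContMDiffAt 𝓘(ℝ, ℝ × E4) (𝓡 4) ∞ (fun z : ℝ × E4 ↦ e.symm z.2) (0, x₀) :=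
      ContMDiffAt.comp (I' := 𝓘(ℝ, E4)) ((0 : ℝ), x₀)
        ((contMDiffOn_extChartAt_symm q).contMDiffAt htgt) contDiff_snd.contMDiff.contMDiffAt
    have h2 : ContMDiffAt 𝓘(ℝ, ℝ × E4) (𝓘(ℝ, ℝ).prod (𝓡 4)) ∞
        (fun z : ℝ × E4 ↦ (z.1, e.symm z.2)) (0, x₀) :=
      (contDiff_fst.contMDiff.contMDiffAt).prodMk h1
    have h3 : ContMDiffAt 𝓘(ℝ, ℝ × E4) (𝓡 4) ∞ (fun z : ℝ × E4 ↦ φ z.1 (e.symm z.2)) (0, x₀) :=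
      ContMDiffAt.comp (I' := 𝓘(ℝ, ℝ).prod (𝓡 4)) ((0 : ℝ), x₀)
        (hφ.contMDiff.contMDiffAt) h2
    have h4 : ContMDiffAt (𝓡 4) 𝓘(ℝ, E4) ∞ e (φ 0 (e.symm x₀)) := by
      rw [hφ.zero, hq]
      exact contMDiffAt_extChartAt
    have h5 : ContMDiffAt 𝓘(ℝ, ℝ × E4) 𝓘(ℝ, E4) ∞ Φ (0, x₀) :=
      ContMDiffAt.comp (I' := 𝓡 4) ((0 : ℝ), x₀) h4 h3
    exact (contMDiffAt_iff_contDiffAt.1 h5).of_le (by norm_cast)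
  have hΦev : ∀ᶠ z in 𝓝 ((0 : ℝ), x₀), DifferentiableAt ℝ Φ z :=
    (hΦ.eventually (by simp)).mono fun z hz ↦ hz.differentiableAt (by simp)
  have hinr : Filter.Tendsto (fun x : E4 ↦ ((0 : ℝ), x)) (𝓝 x₀) (𝓝 (0, x₀)) :=
    (by fun_prop : Continuous fun x : E4 ↦ ((0 : ℝ), x)).tendsto _
  have h0 : ∀ᶠ x in 𝓝 x₀, Φ (0, x) = x := by
    filter_upwards [htgt] with x hx
    simp only [hΦdef, hφ.zero]
    exact e.right_inv hx
  have hX : ∀ᶠ x in 𝓝 x₀, fderiv ℝ Φ (0, x) (1, 0) = Xe x := by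
    filter_upwards [htgt, hinr.eventually hΦev] with x hx hd
    have h1 : HasDerivAt (fun s : ℝ ↦ Φ (s, x)) (fderiv ℝ Φ (0, x) (1, 0)) 0 :=
      HasFDerivAt.comp_hasDerivAt (f := fun s : ℝ ↦ (s, x)) (0 : ℝ) hd.hasFDerivAt
        ((hasDerivAt_id (0 : ℝ)).prodMk (hasDerivAt_const (0 : ℝ) x))
    have hs : φ 0 (e.symm x) ∈ (chartAt E4 q).source := by
      rw [hφ.zero, ← extChartAt_source (𝓡 4)]
      exact e.map_target hx
    have h2 := (mdifferentiableAt_extChartAt (I := 𝓡 4) hs).hasMFDerivAt.comp (0 : ℝ)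
      (hφ.integralCurve (e.symm x) 0)
    set L : E4 →L[ℝ] E4 := mfderiv (𝓡 4) 𝓘(ℝ, E4) e (φ 0 (e.symm x))
    set v : E4 := X (φ 0 (e.symm x))
    have h3 : HasFDerivAt (fun s ↦ Φ (s, x)) (L.comp ((1 : ℝ →L[ℝ] ℝ).smulRight v)) 0 :=
      hasMFDerivAt_iff_hasFDerivAt.1 h2
    rw [hXe x hx]
    refine (h1.unique h3.hasDerivAt).trans ?_
    have h4 : ∀ p, p = e.symm x → (mfderiv (𝓡 4) 𝓘(ℝ, E4) e p (X p) : E4)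
        = mfderiv (𝓡 4) 𝓘(ℝ, E4) e (e.symm x) (X (e.symm x)) := by rintro _ rfl; rfl
    refine Eq.trans ?_ (h4 _ (hφ.zero _))
    have h5 : ∀ (L : E4 →L[ℝ] E4) (v : E4),
        (L.comp ((1 : ℝ →L[ℝ] ℝ).smulRight v)) 1 = L v := by simp
    exact h5 L v
  have hYd : DifferentiableAt ℝ Ye x₀ := by
    have h1 := MDifferentiableWithinAt.differentiableWithinAt_mpullbackWithin_vectorField
      (I := 𝓡 4) (V := Y) (s := Set.univ) (x := q)
      ((hY.mdifferentiable (by simp)) q).mdifferentiableWithinAt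
    simp only [Set.preimage_univ, Set.univ_inter] at h1
    exact h1.differentiableAt (by rw [ModelWithCorners.range_eq_univ]; exact Filter.univ_mem)
  set A : E4 →L[ℝ] E4 := mfderiv (𝓡 4) 𝓘(ℝ, E4) e q
  have hAi : A.IsInvertible := isInvertible_mfderiv_extChartAt hqs
  -- The bracket on the manifold is by definition the chart bracket transported by `A.inverse`, so
  -- its vanishing descends to the chart.
  have hbr : fderiv ℝ Ye x₀ (Xe x₀) - fderiv ℝ Xe x₀ (Ye x₀) = 0 := by
    have h1 : A.inverse
        (VectorField.lieBracketWithin ℝ Xe Ye (e.symm ⁻¹' Set.univ ∩ Set.range (𝓡 4)) x₀) = 0 :=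
      hXY
    have h2 := congrArg A h1
    rw [hAi.self_apply_inverse, map_zero] at h2
    simpa only [Set.preimage_univ, Set.univ_inter, ModelWithCorners.range_eq_univ, VectorField.lieBracketWithin_univ,
      VectorField.lieBracket] using h2
  have key := hasDerivAt_pullback_localFlow hΦ h0 hX hYd
  rw [hbr] at key
  have key2 := (A.inverse.hasFDerivAt.comp_hasDerivAt (0 : ℝ) key)
  rw [map_zero] at key2
  refine key2.congr_of_eventuallyEq ?_
  have hcont : Filter.Tendsto (fun s ↦ φ s q) (𝓝 0) (𝓝 q) := by
    have := (hφ.continuous_curve q).tendsto 0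
    rwa [hφ.zero] at this
  -- For small s the point φ_s(q) stays in the chart domain, and φ_{-s} carries it back to q; hence
  -- the outer chart derivative is `A` for all such s.
  filter_upwards [hcont.eventually hsrc] with s hs
  set z := φ s q
  have hw : Φ (s, x₀) = e z := by simp only [hΦdef, hq, z]
  have hwt : e z ∈ e.target := e.map_source hs
  have hwz : e.symm (e z) = z := e.left_inv hs
  set S : E4 →L[ℝ] E4 := mfderiv 𝓘(ℝ, E4) (𝓡 4) e.symm (e z)
  have hS : HasMFDerivAt 𝓘(ℝ, E4) (𝓡 4) e.symm (e z) S :=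
    (((contMDiffOn_extChartAt_symm q).contMDiffAt
      ((isOpen_extChartAt_target q).mem_nhds hwt)).mdifferentiableAt (n := ∞)
        (by simp)).hasMFDerivAt
  have hSY : S (Ye (e z)) = Y z := by
    have h1 := mfderivWithin_extChartAt_symm_comp_mfderiv_extChartAt (I := 𝓡 4) hwt
    rw [ModelWithCorners.range_eq_univ, mfderivWithin_univ] at h1
    rw [hYe _ hwt]
    have h2 : ∀ p, p = z → (Y p : E4) = Y z := by rintro _ rfl; rfl
    exact (DFunLike.congr_fun h1 _).trans (h2 _ hwz)
  have hcomp : HasFDerivAt (fun x ↦ Φ (-s, x)) (A.comp ((tangentMapAt (φ (-s)) z).comp S))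
      (e z) := by
    have h1 : HasMFDerivAt (𝓡 4) (𝓡 4) (φ (-s)) (e.symm (e z)) (tangentMapAt (φ (-s)) z) := by
      rw [hwz]
      exact ((hφ.contMDiff_apply (-s)).mdifferentiable (by simp) z).hasMFDerivAt
    have h2 : HasMFDerivAt (𝓡 4) 𝓘(ℝ, E4) e (φ (-s) (e.symm (e z))) A := by
      rw [hwz, hφ.neg_apply_apply]
      exact (mdifferentiableAt_extChartAt (mem_chart_source E4 q)).hasMFDerivAt
    exact hasMFDerivAt_iff_hasFDerivAt.1 (h2.comp (e z) (h1.comp (e z) hS))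
  simp only [Function.comp_apply]
  rw [hw, hcomp.fderiv]
  simp only [ContinuousLinearMap.comp_apply]
  rw [hAi.inverse_apply_self, hSY]

end Flow

/-! ### Commuting flows and their combinations -/

section FlowAlgebra

variable {M : Type*} [TopologicalSpace M] [ChartedSpace (EuclideanSpace ℝ (Fin 4)) M]
  [IsManifold (𝓡 4) ∞ M] {X Y : VField M} {φ ψ : ℝ → M → M}

/-- Vector fields with vanishing Lie bracket: the flow of `X` preserves `Y`. -/
theorem IsFlow.tangentMapAt_apply (hφ : IsFlow X φ)
    (hY : ContMDiff (𝓡 4) (𝓡 4).tangent ∞ (fun p ↦ (⟨p, Y p⟩ : TangentBundle (𝓡 4) M)))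
    (hXY : ∀ q, VectorField.mlieBracket (𝓡 4) X Y q = 0) (t : ℝ) (p : M) :
    tangentMapAt (φ t) p (Y p) = (Y (φ t p) : E4) := by
  set f : ℝ → E4 := fun t ↦ tangentMapAt (φ (-t)) (φ t p) (Y (φ t p)) with hf
  -- By the group law, f(u) is the fixed linear map `L` applied to the pull-back at time u - t based
  -- at φ_t(p), so the derivative at time 0 suffices.
  have hd : ∀ t, HasDerivAt f 0 t := fun t ↦ by
    set L := tangentMapAt (φ (-t)) (φ t p)
    have h1 : HasDerivAt (fun s : ℝ ↦ tangentMapAt (φ (-s)) (φ s (φ t p)) (Y (φ s (φ t p))))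
        (0 : E4) (t - t) := by
      rw [sub_self]
      exact hφ.hasDerivAt_pullback hY (hXY _)
    have h2 := L.hasFDerivAt.comp_hasDerivAt t (h1.comp_sub_const t t)
    rw [map_zero] at h2
    refine h2.congr_of_eventuallyEq (Filter.Eventually.of_forall fun u ↦ ?_)
    have e1 : φ (u - t) (φ t p) = φ u p := by rw [← hφ.add, sub_add_cancel]
    have e2 : φ (-u) = fun x ↦ φ (-t) (φ (-(u - t)) x) := by
      ext x
      rw [← hφ.add]
      congr 1
      ring
    have e3 : φ (-(u - t)) (φ u p) = φ t p := by rw [← e1, hφ.neg_apply_apply]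
    simp only [hf, Function.comp_apply]
    rw [e1, e2, tangentMapAt_comp (hφ.contMDiff_apply _) (hφ.contMDiff_apply _), e3]
    rfl
  have hc : f t = f 0 := is_const_of_deriv_eq_zero (fun t ↦ (hd t).differentiableAt)
    (fun t ↦ (hd t).deriv) t 0
  have e0 : φ 0 = fun x ↦ x := funext hφ.zero
  have hf0 : f 0 = Y p := by
    simp only [hf, neg_zero, e0, tangentMapAt_id]
    exact congrArg (Y : M → E4) (hφ.zero p)
  rw [← hf0, ← hc]
  have e1 := tangentMapAt_comp (hφ.contMDiff_apply t) (hφ.contMDiff_apply (-t)) (φ t p)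
  rw [show (fun x ↦ φ t (φ (-t) x)) = fun x ↦ x from funext fun x ↦ hφ.apply_neg_apply t x,
    tangentMapAt_id, hφ.neg_apply_apply] at e1
  exact (DFunLike.congr_fun e1 _).symm

theorem isMIntegralCurve_comp {γ : ℝ → M} (hγ : IsMIntegralCurve γ X) {h : M → M}
    (hh : ContMDiff (𝓡 4) (𝓡 4) ∞ h)
    (hXY : ∀ p, tangentMapAt h p (X p) = (Y (h p) : E4)) :
    IsMIntegralCurve (fun t ↦ h (γ t)) Y := fun t ↦ by
  have h1 := ((hh.mdifferentiable (by simp)) (γ t)).hasMFDerivAt.comp t (hγ t)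
  have h2 : ∀ (L : E4 →L[ℝ] E4) (v w : E4), L v = w →
      L.comp ((1 : ℝ →L[ℝ] ℝ).smulRight v) = (1 : ℝ →L[ℝ] ℝ).smulRight w := by
    rintro L v _ rfl
    ext
    simp
  have h3 := h2 (tangentMapAt h (γ t)) (X (γ t)) _ (hXY (γ t))
  exact HasMFDerivAt.congr_mfderiv h1 h3

/-- The Hausdorff property enters here: it makes integral curves globally unique. -/
theorem IsFlow.eq_of_isMIntegralCurve [T2Space M] (hφ : IsFlow X φ)
    (hX : ContMDiff (𝓡 4) (𝓡 4).tangent ∞ (fun p ↦ (⟨p, X p⟩ : TangentBundle (𝓡 4) M)))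
    {γ : ℝ → M} (hγ : IsMIntegralCurve γ X) (t : ℝ) : γ t = φ t (γ 0) :=
  congrFun (isMIntegralCurve_Ioo_eq_of_contMDiff_boundaryless (t₀ := 0)
    (hX.of_le (by simp)) hγ (hφ.integralCurve (γ 0)) (hφ.zero _).symm) t

/-- The flow of X preserves Y, hence maps integral curves of Y to integral curves of Y; uniqueness
identifies the image curve. -/
theorem IsFlow.commute [T2Space M] (hφ : IsFlow X φ) (hψ : IsFlow Y ψ)
    (hY : ContMDiff (𝓡 4) (𝓡 4).tangent ∞ (fun p ↦ (⟨p, Y p⟩ : TangentBundle (𝓡 4) M)))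
    (hXY : ∀ q, VectorField.mlieBracket (𝓡 4) X Y q = 0) (s t : ℝ) (p : M) :
    φ s (ψ t p) = ψ t (φ s p) := by
  have h := hψ.eq_of_isMIntegralCurve hY (isMIntegralCurve_comp (hψ.integralCurve p)
    (hφ.contMDiff_apply s) (hφ.tangentMapAt_apply hY hXY s)) t
  rwa [hψ.zero] at h

/-- The flow of a linear combination of two fields with commuting flows. -/
theorem IsFlow.linearCombination (hφ : IsFlow X φ) (hψ : IsFlow Y ψ)
    (hc : ∀ s t p, φ s (ψ t p) = ψ t (φ s p)) (a b : ℝ) :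
    IsFlow (fun p ↦ a • X p + b • Y p) (fun t p ↦ φ (a * t) (ψ (b * t) p)) where
  contMDiff := by
    have h1 : ∀ c : ℝ, ContMDiff (𝓘(ℝ, ℝ).prod (𝓡 4)) 𝓘(ℝ, ℝ) ∞
        (fun z : ℝ × M ↦ c * z.1) := fun c ↦
      (contDiff_const.mul contDiff_id : ContDiff ℝ ∞ fun x : ℝ ↦ c * x).contMDiff.comp contMDiff_fst
    exact hφ.contMDiff.comp ((h1 a).prodMk (hψ.contMDiff.comp ((h1 b).prodMk contMDiff_snd)))
  zero p := by rw [mul_zero, mul_zero, hψ.zero, hφ.zero]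
  add s t p := by rw [mul_add, mul_add, hφ.add, hψ.add, hc (a * t)]
  integralCurve p t := by
    set G : ℝ × ℝ → M := fun z ↦ φ z.1 (ψ z.2 p) with hG
    have hGs : ContMDiff 𝓘(ℝ, ℝ × ℝ) (𝓡 4) ∞ G :=
      hφ.contMDiff.comp (contDiff_fst.contMDiff.prodMk
        (hψ.contMDiff.comp (contDiff_snd.contMDiff.prodMk contMDiff_const)))
    set z : ℝ × ℝ := (a * t, b * t)
    set q := G z with hq
    set D : ℝ × ℝ →L[ℝ] E4 := mfderiv 𝓘(ℝ, ℝ × ℝ) (𝓡 4) G z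
    have hD : HasMFDerivAt 𝓘(ℝ, ℝ × ℝ) (𝓡 4) G z D :=
      (hGs.mdifferentiable (by simp) z).hasMFDerivAt
    have hcurve : ∀ {c : ℝ → ℝ × ℝ} {r : ℝ} {v : ℝ × ℝ}, HasDerivAt c v r → c r = z →
        HasMFDerivAt 𝓘(ℝ, ℝ) (𝓡 4) (fun u ↦ G (c u)) r ((1 : ℝ →L[ℝ] ℝ).smulRight (D v)) := by
      intro c r v hcv hz
      have h1 : HasMFDerivAt 𝓘(ℝ, ℝ) 𝓘(ℝ, ℝ × ℝ) c r ((1 : ℝ →L[ℝ] ℝ).smulRight v) :=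
        hcv.hasFDerivAt.hasMFDerivAt
      have h2 := HasMFDerivAt.comp r (by rw [hz]; exact hD) h1
      have h3 : D.comp ((1 : ℝ →L[ℝ] ℝ).smulRight v) = (1 : ℝ →L[ℝ] ℝ).smulRight (D v) := by
        ext
        simp
      exact HasMFDerivAt.congr_mfderiv h2 h3
    have hone : ∀ {v w : E4}, (1 : ℝ →L[ℝ] ℝ).smulRight v = (1 : ℝ →L[ℝ] ℝ).smulRight w → v = w :=
      fun h ↦ by simpa using DFunLike.congr_fun h 1
    have hD1 : D (1, 0) = X q := by
      have h1 := hcurve (c := fun u ↦ (u, b * t)) (r := a * t)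
        ((hasDerivAt_id _).prodMk (hasDerivAt_const _ _)) rfl
      have h2 := hφ.integralCurve (ψ (b * t) p) (a * t)
      exact hone (hasMFDerivAt_unique h1 h2)
    have hD2 : D (0, 1) = Y q := by
      have h1 := hcurve (c := fun u ↦ (a * t, u)) (r := b * t)
        ((hasDerivAt_const _ _).prodMk (hasDerivAt_id _)) rfl
      have h2 := hψ.integralCurve (φ (a * t) p) (b * t)
      -- The second partial derivative is visible only with ψ outermost; this is where commutation
      -- is used.
      have e : (fun u ↦ ψ u (φ (a * t) p)) = fun u ↦ G (a * t, u) :=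
        funext fun u ↦ (hc _ _ _).symm
      rw [e] at h2
      exact hone (hasMFDerivAt_unique h1 h2)
    have h1 := hcurve (c := fun u ↦ (a * u, b * u)) (r := t)
      (((hasDerivAt_id t).const_mul a).prodMk ((hasDerivAt_id t).const_mul b)) rfl
    have h2 : D (a * 1, b * 1) = (a • X q + b • Y q : E4) := by
      have : ((a * 1, b * 1) : ℝ × ℝ) = a • ((1, 0) : ℝ × ℝ) + b • ((0, 1) : ℝ × ℝ) := by simp
      rw [this, map_add, map_smul, map_smul, hD1, hD2]
      rfl
    rw [h2] at h1
    exact h1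

end FlowAlgebra

/-! ### Isometries and metric preserving flows -/

section Isometries

variable {M : Type*} [TopologicalSpace M] [ChartedSpace (EuclideanSpace ℝ (Fin 4)) M]
  [IsManifold (𝓡 4) ∞ M] {g : LorentzMetric M} {X Y : VField M} {φ ψ : ℝ → M → M}

/-- The metric at a point, as a bilinear form on the model space. -/
def metricAt (g : LorentzMetric M) (p : M) : E4 →L[ℝ] E4 →L[ℝ] ℝ := g.val p

variable (g) in
/-- The map `h` preserves the metric. -/
def PreservesMetric (h : M → M) : Prop :=
  ∀ (p : M) (v w : E4),
    metricAt g (h p) (tangentMapAt h p v) (tangentMapAt h p w) = metricAt g p v w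

theorem PreservesMetric.comp {h k : M → M} (hh : PreservesMetric g h) (hk : PreservesMetric g k)
    (sh : ContMDiff (𝓡 4) (𝓡 4) ∞ h) (sk : ContMDiff (𝓡 4) (𝓡 4) ∞ k) :
    PreservesMetric g (fun x ↦ h (k x)) := fun p v w ↦ by
  rw [tangentMapAt_comp sh sk]
  exact (hh _ _ _).trans (hk _ _ _)

theorem Iso.preservesMetric (h : Iso g) : PreservesMetric g h.1 := h.2.2.2

theorem IsComplete.isFlow (hX : IsComplete X) : IsFlow X (flow X) := by
  rw [flow, dif_pos hX]
  exact hX.choose_spec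

/-- `flow` is a choice. Uniqueness allows the flows of h_*ξ and Nξ to be computed by exhibiting any
flow. -/
theorem IsFlow.flow_eq [T2Space M] (hφ : IsFlow X φ)
    (hX : ContMDiff (𝓡 4) (𝓡 4).tangent ∞ (fun p ↦ (⟨p, X p⟩ : TangentBundle (𝓡 4) M))) :
    flow X = φ := by
  have h : IsFlow X (flow X) := IsComplete.isFlow ⟨φ, hφ⟩
  ext t p
  have := hφ.eq_of_isMIntegralCurve hX (h.integralCurve p) t
  rwa [h.zero] at this

/-- The hypothesis concerns time 0 at every point; the group law transports it to every time, so
φ_t^*g is constant in t. -/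
theorem LieDerivVanishes.preservesMetric (hX : LieDerivVanishes g X) (hc : IsComplete X) (t : ℝ) :
    PreservesMetric g (flow X t) := fun p v w ↦ by
  have hφ := hc.isFlow
  set φ := flow X
  set f : ℝ → ℝ := fun t ↦ metricAt g (φ t p) (tangentMapAt (φ t) p v) (tangentMapAt (φ t) p w)
    with hf
  have hd : ∀ t, HasDerivAt f 0 t := fun t ↦ by
    have h1 : HasDerivAt (fun s ↦ metricAt g (φ s (φ t p))
        (tangentMapAt (φ s) (φ t p) (tangentMapAt (φ t) p v))
        (tangentMapAt (φ s) (φ t p) (tangentMapAt (φ t) p w))) 0 (t - t) := by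
      rw [sub_self]
      exact hX (φ t p) (tangentMapAt (φ t) p v) (tangentMapAt (φ t) p w)
    refine (h1.comp_sub_const t t).congr_of_eventuallyEq (Filter.Eventually.of_forall fun u ↦ ?_)
    have e1 : φ (u - t) (φ t p) = φ u p := by rw [← hφ.add, sub_add_cancel]
    have e2 : φ u = fun x ↦ φ (u - t) (φ t x) := by
      ext x
      rw [← hφ.add, sub_add_cancel]
    have e3 : tangentMapAt (φ u) p
        = (tangentMapAt (φ (u - t)) (φ t p)).comp (tangentMapAt (φ t) p) := by
      rw [← tangentMapAt_comp (hφ.contMDiff_apply _) (hφ.contMDiff_apply _), ← e2]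
    simp only [hf]
    rw [e3, ← e1]
    rfl
  have hc' : f t = f 0 := is_const_of_deriv_eq_zero (fun t ↦ (hd t).differentiableAt)
    (fun t ↦ (hd t).deriv) t 0
  have e0 : φ 0 = fun x ↦ x := funext hφ.zero
  rw [show metricAt g (φ t p) (tangentMapAt (φ t) p v) (tangentMapAt (φ t) p w) = f t from rfl, hc']
  simp only [hf, e0, tangentMapAt_id]
  rfl

theorem lieDerivVanishes_of_preservesMetric (h : ∀ t, PreservesMetric g (flow X t)) :
    LieDerivVanishes g X := fun p v w ↦ by
  have e : (fun t : ℝ ↦ g.val (flow X t p) (mfderiv (𝓡 4) (𝓡 4) (flow X t) p v)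
      (mfderiv (𝓡 4) (𝓡 4) (flow X t) p w)) = fun _ ↦ metricAt g p v w :=
    funext fun t ↦ h t p v w
  rw [e]
  exact hasDerivAt_const _ _

/-- A metric preserving flow acts by isometries. -/
def IsFlow.toIso (hφ : IsFlow X φ) (hg : ∀ t, PreservesMetric g (φ t)) (t : ℝ) : Iso g :=
  ⟨⟨φ t, φ (-t), hφ.neg_apply_apply t, hφ.apply_neg_apply t⟩,
    hφ.contMDiff_apply t, hφ.contMDiff_apply (-t), hg t⟩

theorem Iso.ext {h k : Iso g} (e : ∀ p, h.1 p = k.1 p) : h = k := Subtype.ext (Equiv.ext e)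

theorem Iso.mul_apply (h k : Iso g) (p : M) : (h * k).1 p = h.1 (k.1 p) := rfl

theorem Iso.apply_inv_apply (h : Iso g) (p : M) : h.1 ((h⁻¹).1 p) = p :=
  Equiv.apply_symm_apply h.1 p

theorem Iso.inv_apply_apply (h : Iso g) (p : M) : (h⁻¹).1 (h.1 p) = p :=
  Equiv.symm_apply_apply h.1 p

theorem Iso.contMDiff (h : Iso g) : ContMDiff (𝓡 4) (𝓡 4) ∞ h.1 := h.2.1

theorem Iso.tangentMapAt_comp_inv (h : Iso g) (p : M) :
    (tangentMapAt h.1 ((h⁻¹).1 p)).comp (tangentMapAt (h⁻¹).1 p) = ContinuousLinearMap.id ℝ E4 := by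
  rw [← tangentMapAt_comp (Iso.contMDiff h) (Iso.contMDiff h⁻¹)]
  simp only [Iso.apply_inv_apply h, tangentMapAt_id]

theorem Iso.tangentMapAt_inv_comp (h : Iso g) (p : M) :
    (tangentMapAt (h⁻¹).1 p).comp (tangentMapAt h.1 ((h⁻¹).1 p)) = ContinuousLinearMap.id ℝ E4 := by
  have := Iso.tangentMapAt_comp_inv h⁻¹ ((h⁻¹).1 p)
  rwa [inv_inv, Iso.apply_inv_apply h] at this

theorem pushforward_apply (h : Iso g) (ξ : Fin 2 → VField M) (i : Fin 2) (p : M) :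
    pushforward h ξ i p = tangentMapAt h.1 ((h⁻¹).1 p) (ξ i ((h⁻¹).1 p)) := by
  have e : (tangentMapAt (h⁻¹).1 p).inverse = tangentMapAt h.1 ((h⁻¹).1 p) :=
    ContinuousLinearMap.inverse_eq (Iso.tangentMapAt_inv_comp h p) (Iso.tangentMapAt_comp_inv h p)
  exact DFunLike.congr_fun e _

theorem Iso.isInvertible_mfderiv (h : Iso g) (p : M) :
    (mfderiv (𝓡 4) (𝓡 4) h.1 p).IsInvertible := by
  have h1 := Iso.tangentMapAt_comp_inv h (h.1 p)
  have h2 := Iso.tangentMapAt_inv_comp h (h.1 p)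
  rw [Iso.inv_apply_apply h] at h1 h2
  exact ContinuousLinearMap.IsInvertible.of_inverse (g := tangentMapAt (h⁻¹).1 (h.1 p)) h1 h2

end Isometries

/-! ### Killing pairs: joint flow, push-forward, linear combinations -/

section KillingPairs

variable {M : Type*} [TopologicalSpace M] [T2Space M]
  [ChartedSpace (EuclideanSpace ℝ (Fin 4)) M]
  [IsManifold (𝓡 4) ∞ M] {g : LorentzMetric M} {ξ : Fin 2 → VField M}

theorem IsFlow.conj {X : VField M} {φ : ℝ → M → M} (hφ : IsFlow X φ) (h : Iso g) {Y : VField M}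
    (hY : ∀ p, tangentMapAt h.1 p (X p) = (Y (h.1 p) : E4)) :
    IsFlow Y (fun t p ↦ h.1 (φ t ((h⁻¹).1 p))) where
  contMDiff := (Iso.contMDiff h).comp (hφ.contMDiff.comp
    (contMDiff_fst.prodMk ((Iso.contMDiff h⁻¹).comp contMDiff_snd)))
  zero p := by rw [hφ.zero, Iso.apply_inv_apply h]
  add s t p := by rw [Iso.inv_apply_apply h, hφ.add]
  integralCurve p := isMIntegralCurve_comp (hφ.integralCurve _) (Iso.contMDiff h) hY

namespace IsKillingPair

theorem isFlow (hξ : IsKillingPair g ξ) (i : Fin 2) : IsFlow (ξ i) (flow (ξ i)) :=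
  (hξ.complete i).isFlow

theorem preservesMetric (hξ : IsKillingPair g ξ) (i : Fin 2) (t : ℝ) :
    PreservesMetric g (flow (ξ i) t) :=
  (hξ.killing i).preservesMetric (hξ.complete i) t

theorem flow_commute (hξ : IsKillingPair g ξ) (s t : ℝ) (p : M) :
    flow (ξ 0) s (flow (ξ 1) t p) = flow (ξ 1) t (flow (ξ 0) s p) :=
  (hξ.isFlow 0).commute (hξ.isFlow 1) (hξ.smooth 1) hξ.commute s t p

-- Flows of complete Killing fields are isometries, so the default value 1 in `pairFlow` is never
-- taken.
omit [T2Space M] in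
theorem pairFlow_apply (hξ : IsKillingPair g ξ) (s : Plane) (p : M) :
    (pairFlow g ξ s).1 p = flow (ξ 0) (s 0) (flow (ξ 1) (s 1) p) := by
  have h : ∃ k : Iso g, ∀ p : M, k.1 p = flow (ξ 0) (s 0) (flow (ξ 1) (s 1) p) :=
    ⟨(hξ.complete 0).isFlow.toIso
      ((hξ.killing 0).preservesMetric (hξ.complete 0)) (s 0) *
      (hξ.complete 1).isFlow.toIso
      ((hξ.killing 1).preservesMetric (hξ.complete 1)) (s 1), fun p ↦ rfl⟩
  rw [pairFlow, dif_pos h]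
  exact h.choose_spec p

/-- The homomorphism property on which the form of the amplitude and its symbol bounds rest. -/
theorem pairFlow_add (hξ : IsKillingPair g ξ) (s t : Plane) :
    pairFlow g ξ (s + t) = pairFlow g ξ s * pairFlow g ξ t := Iso.ext fun p ↦ by
  rw [Iso.mul_apply, hξ.pairFlow_apply, hξ.pairFlow_apply, hξ.pairFlow_apply, PiLp.add_apply,
    PiLp.add_apply, (hξ.isFlow 0).add, (hξ.isFlow 1).add, hξ.flow_commute (t 0)]

theorem isSmoothFamily_pairFlow (hξ : IsKillingPair g ξ) : IsSmoothFamily (pairFlow g ξ) := by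
  have h1 : ∀ i : Fin 2, ContMDiff ((𝓡 2).prod (𝓡 4)) 𝓘(ℝ, ℝ) ∞
      (fun z : Plane × M ↦ z.1 i) := fun i ↦
    (contDiff_piLp_apply (p := 2) (i := i) : ContDiff ℝ ∞ fun x : Plane ↦ x i).contMDiff.comp
      contMDiff_fst
  have h2 := (hξ.isFlow 0).contMDiff.comp ((h1 0).prodMk
    ((hξ.isFlow 1).contMDiff.comp ((h1 1).prodMk contMDiff_snd)))
  refine h2.congr fun z ↦ ?_
  exact hξ.pairFlow_apply z.1 z.2

/-! #### Push-forward -/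

theorem isFlow_pushforward (hξ : IsKillingPair g ξ) (h : Iso g) (i : Fin 2) :
    IsFlow (pushforward h ξ i) (fun t p ↦ h.1 (flow (ξ i) t ((h⁻¹).1 p))) :=
  (hξ.isFlow i).conj h fun p ↦ by
    rw [pushforward_apply, Iso.inv_apply_apply h]

theorem contMDiff_pushforward (hξ : IsKillingPair g ξ) (h : Iso g) (i : Fin 2) :
    ContMDiff (𝓡 4) (𝓡 4).tangent ∞
      (fun p ↦ (⟨p, pushforward h ξ i p⟩ : TangentBundle (𝓡 4) M)) :=
  ContMDiff.mpullback_vectorField (n := ∞) (hξ.smooth i) (Iso.contMDiff h⁻¹)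
    (Iso.isInvertible_mfderiv h⁻¹) (by simp)

theorem flow_pushforward (hξ : IsKillingPair g ξ) (h : Iso g) (i : Fin 2) :
    flow (pushforward h ξ i) = fun t p ↦ h.1 (flow (ξ i) t ((h⁻¹).1 p)) :=
  (hξ.isFlow_pushforward h i).flow_eq (hξ.contMDiff_pushforward h i)

protected theorem pushforward (hξ : IsKillingPair g ξ) (h : Iso g) :
    IsKillingPair g (pushforward h ξ) where
  smooth := hξ.contMDiff_pushforward h
  complete i := ⟨_, hξ.isFlow_pushforward h i⟩
  killing i := lieDerivVanishes_of_preservesMetric fun t ↦ by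
    rw [hξ.flow_pushforward]
    have s1 := ((hξ.isFlow i).contMDiff_apply t)
    have s2 := Iso.contMDiff h⁻¹
    exact (Iso.preservesMetric h).comp ((hξ.preservesMetric i t).comp (Iso.preservesMetric h⁻¹) s1 s2)
      (Iso.contMDiff h) (s1.comp s2)
  commute p := by
    have : IsManifold (𝓡 4) (minSmoothness ℝ 2) M := by
      rw [minSmoothness_of_isRCLikeNormedField]
      infer_instance
    have h1 := VectorField.mpullback_mlieBracket (I := 𝓡 4) (I' := 𝓡 4) (n := ∞) (x₀ := p)
      (f := (h⁻¹).1) (V := ξ 0) (W := ξ 1) ((hξ.smooth 0).mdifferentiable (by simp) _)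
      ((hξ.smooth 1).mdifferentiable (by simp) _) (Iso.contMDiff h⁻¹ p)
      (by rw [minSmoothness_of_isRCLikeNormedField]; norm_cast)
    refine h1.symm.trans ?_
    rw [VectorField.mpullback_apply, hξ.commute, map_zero]
  linearIndependent p := by
    have h1 : LinearIndependent ℝ (fun i ↦ (ξ i ((h⁻¹).1 p) : E4)) := hξ.linearIndependent _
    have hinj : Function.Injective (tangentMapAt h.1 ((h⁻¹).1 p)) := fun v w e ↦ by
      have h2 := congrArg (tangentMapAt (h⁻¹).1 p) e
      have h3 := fun v ↦ DFunLike.congr_fun (Iso.tangentMapAt_inv_comp h p) v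
      exact (h3 v).symm.trans (h2.trans (h3 w))
    have h2 := h1.map' (tangentMapAt h.1 ((h⁻¹).1 p)).toLinearMap (LinearMap.ker_eq_bot.2 hinj)
    exact (funext fun i ↦ pushforward_apply h ξ i p :
      (fun i ↦ (pushforward h ξ i p : E4)) = _) ▸ h2
  spacelike p c hc := by
    have h1 := hξ.spacelike ((h⁻¹).1 p) c hc
    set T := tangentMapAt h.1 ((h⁻¹).1 p)
    set a : Fin 2 → E4 := fun i ↦ ξ i ((h⁻¹).1 p)
    set b : Fin 2 → E4 := fun i ↦ pushforward h ξ i p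
    have e : ∑ i, c i • b i = T (∑ i, c i • a i) := by
      rw [map_sum]
      refine Finset.sum_congr rfl fun i _ ↦ ?_
      rw [map_smul]
      exact congrArg (c i • ·) (pushforward_apply h ξ i p)
    have h2 := Iso.preservesMetric h ((h⁻¹).1 p) (∑ i, c i • a i) (∑ i, c i • a i)
    rw [Iso.apply_inv_apply h] at h2
    change metricAt g p (∑ i, c i • b i) (∑ i, c i • b i) < 0
    rw [e]
    exact lt_of_eq_of_lt h2 h1

theorem pairFlow_pushforward (hξ : IsKillingPair g ξ) (h : Iso g) (s : Plane) :
    pairFlow g (pushforward h ξ) s = h * pairFlow g ξ s * h⁻¹ := Iso.ext fun p ↦ by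
  rw [(hξ.pushforward h).pairFlow_apply, hξ.flow_pushforward, hξ.flow_pushforward,
    Iso.mul_apply, Iso.mul_apply, hξ.pairFlow_apply]
  simp only [Iso.inv_apply_apply h]

/-! #### Linear combinations -/

theorem isFlow_linComb (hξ : IsKillingPair g ξ) (N : Matrix (Fin 2) (Fin 2) ℝ) (i : Fin 2) :
    IsFlow (linComb N ξ i) (fun t p ↦ flow (ξ 0) (N i 0 * t) (flow (ξ 1) (N i 1 * t) p)) := by
  have h := (hξ.isFlow 0).linearCombination (hξ.isFlow 1) hξ.flow_commute (N i 0) (N i 1)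
  have e : linComb N ξ i = fun p ↦ N i 0 • ξ 0 p + N i 1 • ξ 1 p := by
    ext1 p
    exact Fin.sum_univ_two _
  rwa [e]

theorem contMDiff_linComb (hξ : IsKillingPair g ξ) (N : Matrix (Fin 2) (Fin 2) ℝ) (i : Fin 2) :
    ContMDiff (𝓡 4) (𝓡 4).tangent ∞
      (fun p ↦ (⟨p, linComb N ξ i p⟩ : TangentBundle (𝓡 4) M)) :=
  ContMDiff.sum_section fun j _ ↦ (hξ.smooth j).const_smul_section (a := N i j)

theorem flow_linComb (hξ : IsKillingPair g ξ) (N : Matrix (Fin 2) (Fin 2) ℝ) (i : Fin 2) :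
    flow (linComb N ξ i) = fun t p ↦ flow (ξ 0) (N i 0 * t) (flow (ξ 1) (N i 1 * t) p) :=
  (hξ.isFlow_linComb N i).flow_eq (hξ.contMDiff_linComb N i)

theorem sum_smul_linComb (ξ : Fin 2 → VField M) (N : Matrix (Fin 2) (Fin 2) ℝ) (c : Fin 2 → ℝ)
    (p : M) : ∑ i, c i • linComb N ξ i p = ∑ j, (Matrix.vecMul c N) j • ξ j p := by
  simp only [linComb, Fin.sum_univ_two, Matrix.vecMul, dotProduct]
  module

omit [T2Space M] [ChartedSpace (EuclideanSpace ℝ (Fin 4)) M] [IsManifold (𝓡 4) ∞ M]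
  [TopologicalSpace M] in
theorem eq_zero_of_vecMul_eq_zero (N : GL (Fin 2) ℝ) {c : Fin 2 → ℝ}
    (h : Matrix.vecMul c N.1 = 0) : c = 0 := by
  have h1 := congrArg (fun x ↦ Matrix.vecMul x (N⁻¹).1) h
  simpa [Matrix.vecMul_vecMul, ← Units.val_mul] using h1

protected theorem linComb (hξ : IsKillingPair g ξ) (N : GL (Fin 2) ℝ) :
    IsKillingPair g (linComb N.1 ξ) where
  smooth := hξ.contMDiff_linComb N.1
  complete i := ⟨_, hξ.isFlow_linComb N.1 i⟩
  killing i := lieDerivVanishes_of_preservesMetric fun t ↦ by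
    rw [hξ.flow_linComb]
    exact (hξ.preservesMetric 0 _).comp (hξ.preservesMetric 1 _)
      ((hξ.isFlow 0).contMDiff_apply _) ((hξ.isFlow 1).contMDiff_apply _)
  commute p := by
    have e : ∀ i, linComb N.1 ξ i = N.1 i 0 • ξ 0 + N.1 i 1 • ξ 1 := fun i ↦
      funext fun p ↦ Fin.sum_univ_two _
    have d : ∀ i, MDifferentiableAt (𝓡 4) (𝓡 4).tangent
        (fun p ↦ (⟨p, ξ i p⟩ : TangentBundle (𝓡 4) M)) p := fun i ↦
      (hξ.smooth i).mdifferentiable (by simp) p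
    have ds : ∀ (i) (c : ℝ), MDifferentiableAt (𝓡 4) (𝓡 4).tangent
        (fun p ↦ (⟨p, (c • ξ i) p⟩ : TangentBundle (𝓡 4) M)) p := fun i c ↦
      ((hξ.smooth i).const_smul_section (a := c)).mdifferentiable (by simp) p
    have da := (hξ.contMDiff_linComb N.1 1).mdifferentiable (n := ∞) (by simp) p
    have hc : VectorField.mlieBracket (𝓡 4) (ξ 1) (ξ 0) p = 0 := by
      rw [VectorField.mlieBracket_swap_apply, hξ.commute, neg_zero]
    rw [e 0, VectorField.mlieBracket_add_left (ds 0 _) (ds 1 _),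
      VectorField.mlieBracket_const_smul_left (d 0), VectorField.mlieBracket_const_smul_left (d 1),
      e 1, VectorField.mlieBracket_add_right (ds 0 _) (ds 1 _),
      VectorField.mlieBracket_add_right (ds 0 _) (ds 1 _),
      VectorField.mlieBracket_const_smul_right (d 0),
      VectorField.mlieBracket_const_smul_right (d 1),
      VectorField.mlieBracket_const_smul_right (d 0),
      VectorField.mlieBracket_const_smul_right (d 1), hξ.commute, hc,
      VectorField.mlieBracket_self, VectorField.mlieBracket_self]
    simp
  linearIndependent p := by
    rw [Fintype.linearIndependent_iff]
    intro c hc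
    rw [sum_smul_linComb] at hc
    have h1 := Fintype.linearIndependent_iff.1 (hξ.linearIndependent p) _ hc
    exact congrFun (eq_zero_of_vecMul_eq_zero N (funext h1))
  spacelike p c hc := by
    rw [sum_smul_linComb]
    exact hξ.spacelike p _ fun h0 ↦ hc (eq_zero_of_vecMul_eq_zero N h0)

/-- The transpose appears because the time spent along ξ_j is ∑ᵢ sᵢ Nᵢⱼ. -/
theorem pairFlow_linComb (hξ : IsKillingPair g ξ) (N : GL (Fin 2) ℝ) (s : Plane) :
    pairFlow g (linComb N.1 ξ) s = pairFlow g ξ (Matrix.toEuclideanLin N.1.transpose s) :=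
  Iso.ext fun p ↦ by
    rw [(hξ.linComb N).pairFlow_apply, hξ.flow_linComb, hξ.flow_linComb, hξ.pairFlow_apply]
    simp only
    rw [← hξ.flow_commute, ← (hξ.isFlow 0).add, ← (hξ.isFlow 1).add]
    simp [Matrix.toEuclideanLin, Matrix.toLpLin_apply]

end IsKillingPair

end KillingPairs

/-! ### Covariance of the oscillatory integrals -/

section Covariance

variable {M : Type*} [TopologicalSpace M] [ChartedSpace (EuclideanSpace ℝ (Fin 4)) M]
  [IsManifold (𝓡 4) ∞ M] {H : Type*} [NormedAddCommGroup H] [InnerProductSpace ℂ H]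
  [CompleteSpace H] {g : LorentzMetric M} (U : Iso g →* unitary (H →L[ℂ] H))
  {ξ : Fin 2 → VField M} {lam : ℝ} {F : H →L[ℂ] H} {Ψ Φ : H}

theorem rep_mul_apply (h k : Iso g) (Ψ : H) :
    (U (h * k) : H →L[ℂ] H) Ψ = (U h : H →L[ℂ] H) ((U k : H →L[ℂ] H) Ψ) := by
  rw [map_mul]
  rfl

theorem rep_one_apply (Ψ : H) : (U 1 : H →L[ℂ] H) Ψ = Ψ := by
  rw [map_one]
  rfl

theorem rep_inv_apply (h : Iso g) (Ψ : H) :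
    (U h⁻¹ : H →L[ℂ] H) ((U h : H →L[ℂ] H) Ψ) = Ψ := by
  rw [← rep_mul_apply, inv_mul_cancel, rep_one_apply]

theorem rep_apply_inv (h : Iso g) (Ψ : H) :
    (U h : H →L[ℂ] H) ((U h⁻¹ : H →L[ℂ] H) Ψ) = Ψ := by
  rw [← rep_mul_apply, mul_inv_cancel, rep_one_apply]

theorem norm_rep_apply (h : Iso g) (Ψ : H) : ‖(U h : H →L[ℂ] H) Ψ‖ = ‖Ψ‖ :=
  ContinuousLinearMap.norm_map_of_mem_unitary (U h).2 Ψ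

theorem adj_apply (h : Iso g) (F : H →L[ℂ] H) (Ψ : H) :
    adj U h F Ψ = (U h : H →L[ℂ] H) (F ((U h⁻¹ : H →L[ℂ] H) Ψ)) := rfl

theorem adj_mul (h k : Iso g) (F : H →L[ℂ] H) : adj U (h * k) F = adj U h (adj U k F) := by
  ext Ψ
  simp only [adj_apply, mul_inv_rev, rep_mul_apply]

/-- The adjoint action of a single isometry is a linear isometry of the bounded operators. -/
def adjₗᵢ (h : Iso g) : (H →L[ℂ] H) →ₗᵢ[ℝ] (H →L[ℂ] H) where
  toFun F := adj U h F
  map_add' F G := by simp [adj, mul_add, add_mul]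
  map_smul' c F := by simp [adj]
  norm_map' F := by
    have hle : ∀ (k : Iso g) (G : H →L[ℂ] H), ‖adj U k G‖ ≤ ‖G‖ := fun k G ↦ by
      refine ContinuousLinearMap.opNorm_le_bound _ (norm_nonneg _) fun Ψ ↦ ?_
      rw [adj_apply, norm_rep_apply]
      exact (G.le_opNorm _).trans_eq (by rw [norm_rep_apply])
    refine le_antisymm (hle h F) ?_
    have h1 := hle h⁻¹ (adj U h F)
    rw [← adj_mul, inv_mul_cancel] at h1
    have h2 : adj U 1 F = F := by
      ext Ψ
      rw [adj_apply, inv_one, rep_one_apply, rep_one_apply]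
    rwa [h2] at h1

/-- A representation operator as a real linear isometry. -/
def repₗᵢ (h : Iso g) : H →ₗᵢ[ℝ] H where
  toLinearMap := (((U h : H →L[ℂ] H) : H →ₗ[ℂ] H)).restrictScalars ℝ
  norm_map' := norm_rep_apply U h

/-- Right translation by a fixed isometry maps smooth families to smooth families. -/
theorem rep_mem_smoothVectors (h : Iso g) (hΨ : Ψ ∈ smoothVectors U) :
    (U h : H →L[ℂ] H) Ψ ∈ smoothVectors U := fun k P hP ↦ by
  have h1 : IsSmoothFamily fun u ↦ P u * h :=
    hP.comp (contMDiff_fst.prodMk ((Iso.contMDiff h).comp contMDiff_snd))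
  simpa only [rep_mul_apply] using hΨ k _ h1

/-! #### Behaviour under isometries -/

theorem IsKillingPair.integrand_pushforward [T2Space M] (hξ : IsKillingPair g ξ) (h : Iso g)
    (χ : Plane × Plane → ℂ) (ε : ℝ) (z : Plane × Plane) :
    integrand U (pushforward h ξ) lam (adj U h F) Ψ χ ε z
      = (U h : H →L[ℂ] H) (integrand U ξ lam F ((U h⁻¹ : H →L[ℂ] H) Ψ) χ ε z) := by
  simp only [integrand, hξ.pairFlow_pushforward, map_smul, adj_apply, rep_mul_apply, rep_inv_apply]

theorem HasDeformedValue.map {ξ' : Fin 2 → VField M} {lam' : ℝ} {F' : H →L[ℂ] H} {Ψ' : H}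
    (hv : HasDeformedValue U ξ lam F Ψ Φ) (V : H →L[ℂ] H)
    (hV : ∀ χ ε z, integrand U ξ' lam' F' Ψ' χ ε z = V (integrand U ξ lam F Ψ χ ε z)) :
    HasDeformedValue U ξ' lam' F' Ψ' (V Φ) := by
  intro χ hχ
  obtain ⟨h1, h2⟩ := hv χ hχ
  have e : ∀ ε, integrand U ξ' lam' F' Ψ' χ ε = fun z ↦ V (integrand U ξ lam F Ψ χ ε z) :=
    fun ε ↦ funext (hV χ ε)
  refine ⟨fun ε hε ↦ by rw [e]; exact V.integrable_comp (h1 ε hε), ?_⟩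
  refine ((V.continuous.tendsto Φ).comp h2).congr' ?_
  filter_upwards [self_mem_nhdsWithin] with ε hε
  rw [Function.comp_apply, map_smul, e, ContinuousLinearMap.integral_comp_comm _ (h1 ε hε)]

theorem IsKillingPair.hasDeformedValue_pushforward_iff [T2Space M] (hξ : IsKillingPair g ξ)
    (h : Iso g) :
    HasDeformedValue U (pushforward h ξ) lam (adj U h F) Ψ Φ ↔
      HasDeformedValue U ξ lam F ((U h⁻¹ : H →L[ℂ] H) Ψ) ((U h⁻¹ : H →L[ℂ] H) Φ) := by
  refine ⟨fun hv ↦ hv.map U _ fun χ ε z ↦ ?_, fun hv ↦ ?_⟩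
  · rw [hξ.integrand_pushforward, rep_inv_apply]
  · have := hv.map U (U h : H →L[ℂ] H) (hξ.integrand_pushforward U h (Ψ := Ψ))
    rwa [rep_apply_inv] at this

/-! #### Behaviour under linear changes of the pair -/

theorem inner_toEuclideanLin (N : Matrix (Fin 2) (Fin 2) ℝ) (s t : Plane) :
    inner ℝ (Matrix.toEuclideanLin N s) t = inner ℝ s (Matrix.toEuclideanLin N.transpose t) := by
  simp [Matrix.toEuclideanLin, Matrix.toLpLin_apply, PiLp.inner_apply, Fin.sum_univ_two]
  ring

/-- Q is the standard symplectic form of the plane, so NᵀQN = det N · Q. This is the origin of the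
determinant. -/
theorem toEuclideanLin_transpose_Q (N : Matrix (Fin 2) (Fin 2) ℝ) (s : Plane) :
    Matrix.toEuclideanLin N.transpose (Q (Matrix.toEuclideanLin N s)) = N.det • Q s := by
  ext i
  fin_cases i <;>
  · simp [Q, Matrix.toEuclideanLin, Matrix.toLpLin_apply, Fin.sum_univ_two,
      dotProduct, Matrix.det_fin_two]
    ring

/-- The linear automorphism of the plane given by an invertible matrix. -/
def planeEquiv (N : GL (Fin 2) ℝ) : Plane ≃L[ℝ] Plane :=
  LinearEquiv.toContinuousLinearEquiv <| LinearEquiv.ofLinearMap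
    (Matrix.toEuclideanLin N.1) (Matrix.toEuclideanLin (N⁻¹).1)
    (by rw [← Matrix.toLpLin_mul_same, ← Units.val_mul, mul_inv_cancel]; simp)
    (by rw [← Matrix.toLpLin_mul_same, ← Units.val_mul, inv_mul_cancel]; simp)

/-- The transpose of an invertible matrix, as an invertible matrix. -/
def transposeGL (N : GL (Fin 2) ℝ) : GL (Fin 2) ℝ where
  val := N.1.transpose
  inv := (N⁻¹).1.transpose
  val_inv := by rw [← Matrix.transpose_mul, ← Units.val_mul, inv_mul_cancel]; simp
  inv_val := by rw [← Matrix.transpose_mul, ← Units.val_mul, mul_inv_cancel]; simp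

/-- The symplectic change of variables `(s, s') ↦ (N s, N⁻ᵀ s')`. -/
def phaseEquiv (N : GL (Fin 2) ℝ) : (Plane × Plane) ≃L[ℝ] (Plane × Plane) :=
  (planeEquiv N).prodCongr (planeEquiv (transposeGL N)⁻¹)

instance : (volume : Measure (Plane × Plane)).IsAddHaarMeasure := by
  rw [Measure.volume_eq_prod]
  infer_instance

theorem measurePreserving_phaseEquiv (N : GL (Fin 2) ℝ) :
    MeasurePreserving (phaseEquiv N) := by
  set f : Plane × Plane →ₗ[ℝ] Plane × Plane := LinearMap.prodMap
    (Matrix.toEuclideanLin N.1) (Matrix.toEuclideanLin (N⁻¹).1.transpose)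
  -- The two blocks contribute det N and its inverse.
  have hdet : LinearMap.det f = 1 := by
    rw [LinearMap.det_prodMap, Matrix.toEuclideanLin, LinearMap.det_toLpLin,
      LinearMap.det_toLpLin, Matrix.det_transpose, ← Matrix.det_mul, ← Units.val_mul,
      mul_inv_cancel, Units.val_one, Matrix.det_one]
  have h := Measure.map_linearMap_addHaar_eq_smul_addHaar (volume : Measure (Plane × Plane))
    (f := f) (by rw [hdet]; exact one_ne_zero)
  rw [hdet, inv_one, abs_one, ENNReal.ofReal_one, one_smul] at h
  exact ⟨(phaseEquiv N).continuous.measurable, h⟩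

theorem transpose_phaseEquiv_snd (N : GL (Fin 2) ℝ) (z : Plane × Plane) :
    Matrix.toEuclideanLin N.1.transpose (phaseEquiv N z).2 = z.2 :=
  (planeEquiv (transposeGL N)).apply_symm_apply z.2

theorem IsKillingPair.integrand_linComb [T2Space M] (hξ : IsKillingPair g ξ) (N : GL (Fin 2) ℝ)
    (χ : Plane × Plane → ℂ) (ε : ℝ) (z : Plane × Plane) :
    integrand U (linComb N.1 ξ) lam F Ψ χ ε (phaseEquiv N z)
      = integrand U ξ (N.1.det * lam) F Ψ (fun z ↦ χ (phaseEquiv N z)) ε z := by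
  have e1 : (inner ℝ (phaseEquiv N z).1 (phaseEquiv N z).2 : ℝ) = inner ℝ z.1 z.2 := by
    have : (phaseEquiv N z).1 = Matrix.toEuclideanLin N.1 z.1 := rfl
    rw [this, inner_toEuclideanLin, transpose_phaseEquiv_snd]
  have e2 : Matrix.toEuclideanLin N.1.transpose (lam • Q (phaseEquiv N z).1)
      = (N.1.det * lam) • Q z.1 := by
    have : (phaseEquiv N z).1 = Matrix.toEuclideanLin N.1 z.1 := rfl
    rw [this, map_smul, toEuclideanLin_transpose_Q, smul_smul, mul_comm]
  simp only [integrand, hξ.pairFlow_linComb, map_sub, e1, e2, transpose_phaseEquiv_snd, map_smul]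

theorem IsCutoff.comp_equiv {χ : Plane × Plane → ℂ} (hχ : IsCutoff χ)
    (e : (Plane × Plane) ≃L[ℝ] (Plane × Plane)) : IsCutoff fun z ↦ χ (e z) where
  contDiff := hχ.contDiff.comp e.contDiff
  hasCompactSupport := hχ.hasCompactSupport.comp_homeomorph e.toHomeomorph
  apply_zero := by rw [map_zero, hχ.apply_zero]

/-- The substitution replaces χ by its composite with `phaseEquiv N`. Since the deformed value
quantifies over all cutoffs and this composition permutes them, the two conditions coincide. -/
theorem IsKillingPair.hasDeformedValue_linComb_iff [T2Space M] (hξ : IsKillingPair g ξ)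
    (N : GL (Fin 2) ℝ) :
    HasDeformedValue U (linComb N.1 ξ) lam F Ψ Φ ↔
      HasDeformedValue U ξ (N.1.det * lam) F Ψ Φ := by
  have hmp := measurePreserving_phaseEquiv N
  have hemb : MeasurableEmbedding (phaseEquiv N) := (phaseEquiv N).toHomeomorph.measurableEmbedding
  have hI : ∀ χ ε, Integrable (integrand U (linComb N.1 ξ) lam F Ψ χ ε) ↔
      Integrable (integrand U ξ (N.1.det * lam) F Ψ (fun z ↦ χ (phaseEquiv N z)) ε) := by
    intro χ ε
    rw [← hmp.integrable_comp_emb hemb]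
    rw [← show integrand U (linComb N.1 ξ) lam F Ψ χ ε ∘ phaseEquiv N = _ from
      funext (hξ.integrand_linComb U N χ ε)]
  have hE : ∀ χ ε, ∫ z, integrand U (linComb N.1 ξ) lam F Ψ χ ε z =
      ∫ z, integrand U ξ (N.1.det * lam) F Ψ (fun z ↦ χ (phaseEquiv N z)) ε z := by
    intro χ ε
    rw [← hmp.integral_comp hemb]
    exact integral_congr_ae (Filter.Eventually.of_forall (hξ.integrand_linComb U N χ ε))
  constructor
  · intro h χ hχ
    have := h _ (hχ.comp_equiv (phaseEquiv N).symm)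
    simpa only [hI, hE, ContinuousLinearEquiv.symm_apply_apply] using this
  · intro h χ hχ
    have := h _ (hχ.comp_equiv (phaseEquiv N))
    simpa only [hI, hE] using this

/-! #### The deformed operators -/

theorem deformedCore_apply {Ψ : (deformedCore U ξ lam F).domain} :
    HasDeformedValue U ξ lam F Ψ (deformedCore U ξ lam F Ψ) :=
  Ψ.2.2.choose_spec

theorem mem_domain_deformedCore :
    Ψ ∈ (deformedCore U ξ lam F).domain ↔
      Ψ ∈ smoothVectors U ∧ ∃ Φ, HasDeformedValue U ξ lam F Ψ Φ := Iff.rfl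

theorem deformedCore_congr {ξ' : Fin 2 → VField M} {lam' : ℝ} {F' : H →L[ℂ] H}
    (h : ∀ Ψ Φ, HasDeformedValue U ξ lam F Ψ Φ ↔ HasDeformedValue U ξ' lam' F' Ψ Φ) :
    deformedCore U ξ lam F = deformedCore U ξ' lam' F' := by
  refine LinearPMap.ext (Submodule.ext fun Ψ ↦ ?_) fun x hx hx' ↦ ?_
  · simp only [mem_domain_deformedCore, h]
  · exact ((h _ _).1 (deformedCore_apply U (Ψ := ⟨x, hx⟩))).unique
      (deformedCore_apply U (Ψ := ⟨x, hx'⟩))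

theorem IsKillingPair.adjPMap_deformedCore [T2Space M] (hξ : IsKillingPair g ξ) (h : Iso g) :
    adjPMap U h (deformedCore U ξ lam F)
      = deformedCore U (pushforward h ξ) lam (adj U h F) := by
  refine LinearPMap.ext (Submodule.ext fun Ψ ↦ ?_) fun x hx hx' ↦ ?_
  · change (U h⁻¹ : H →L[ℂ] H) Ψ ∈ (deformedCore U ξ lam F).domain ↔ _
    simp only [mem_domain_deformedCore]
    refine and_congr ⟨fun h1 ↦ ?_, fun h1 ↦ rep_mem_smoothVectors U _ h1⟩
      ⟨fun ⟨Φ, hΦ⟩ ↦ ⟨(U h : H →L[ℂ] H) Φ, by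
        rwa [hξ.hasDeformedValue_pushforward_iff, rep_inv_apply]⟩,
        fun ⟨Φ, hΦ⟩ ↦ ⟨_, (hξ.hasDeformedValue_pushforward_iff U h).1 hΦ⟩⟩
    rw [← rep_apply_inv U h Ψ]
    exact rep_mem_smoothVectors U h h1
  · have h1 := deformedCore_apply U (Ψ := ⟨(U h⁻¹ : H →L[ℂ] H) x, hx⟩)
    refine HasDeformedValue.unique (U := U) ?_ (deformedCore_apply U (Ψ := ⟨x, hx'⟩))
    rw [hξ.hasDeformedValue_pushforward_iff]
    change HasDeformedValue U ξ lam F ((U h⁻¹ : H →L[ℂ] H) x) ((U h⁻¹ : H →L[ℂ] H)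
      ((U h : H →L[ℂ] H) (deformedCore U ξ lam F ⟨(U h⁻¹ : H →L[ℂ] H) x, hx⟩)))
    rw [rep_inv_apply]
    exact h1

/-! #### Closures -/

theorem mem_graph_adjPMap (h : Iso g) (T : H →ₗ.[ℂ] H) (z : H × H) :
    z ∈ (adjPMap U h T).graph ↔
      ((U h⁻¹ : H →L[ℂ] H) z.1, (U h⁻¹ : H →L[ℂ] H) z.2) ∈ T.graph := by
  simp only [LinearPMap.mem_graph_iff]
  constructor
  · rintro ⟨y, hy, hy'⟩
    refine ⟨⟨(U h⁻¹ : H →L[ℂ] H) y, y.2⟩, congrArg _ hy, ?_⟩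
    rw [← hy']
    exact (rep_inv_apply U h _).symm
  · rintro ⟨y, hy, hy'⟩
    have hz : (U h⁻¹ : H →L[ℂ] H) z.1 ∈ T.domain := by
      have := y.2
      rwa [hy] at this
    refine ⟨⟨z.1, hz⟩, rfl, ?_⟩
    change (U h : H →L[ℂ] H) (T ⟨(U h⁻¹ : H →L[ℂ] H) z.1, hz⟩) = z.2
    rw [show (⟨(U h⁻¹ : H →L[ℂ] H) z.1, hz⟩ : T.domain) = y from Subtype.ext hy.symm, hy',
      rep_apply_inv]

theorem graph_adjPMap_topologicalClosure (h : Iso g) {T T' : H →ₗ.[ℂ] H}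
    (hT : T.graph.topologicalClosure = T'.graph) :
    (adjPMap U h T).graph.topologicalClosure = (adjPMap U h T').graph := by
  let Θ : H × H ≃ₜ H × H :=
    { toFun := fun z ↦ ((U h⁻¹ : H →L[ℂ] H) z.1, (U h⁻¹ : H →L[ℂ] H) z.2)
      invFun := fun z ↦ ((U h : H →L[ℂ] H) z.1, (U h : H →L[ℂ] H) z.2)
      left_inv := fun z ↦ by simp only [rep_apply_inv]
      right_inv := fun z ↦ by simp only [rep_inv_apply]
      continuous_toFun := by fun_prop
      continuous_invFun := by fun_prop }
  have e : ∀ T : H →ₗ.[ℂ] H, ((adjPMap U h T).graph : Set (H × H)) = Θ ⁻¹' T.graph :=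
    fun T ↦ Set.ext (mem_graph_adjPMap U h T)
  apply SetLike.coe_injective
  rw [Submodule.topologicalClosure_coe, e, e, ← Θ.preimage_closure, ← hT,
    Submodule.topologicalClosure_coe]

theorem adjPMap_inv_adjPMap (h : Iso g) (T : H →ₗ.[ℂ] H) :
    adjPMap U h⁻¹ (adjPMap U h T) = T := by
  refine LinearPMap.eq_of_eq_graph (Submodule.ext fun z ↦ ?_)
  simp only [mem_graph_adjPMap, inv_inv, rep_inv_apply]

theorem isClosable_adjPMap (h : Iso g) {T : H →ₗ.[ℂ] H} (hT : T.IsClosable) :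
    (adjPMap U h T).IsClosable :=
  ⟨_, graph_adjPMap_topologicalClosure U h hT.graph_closure_eq_closure_graph⟩

/-- A non-closable operator has itself as its `closure`. As conjugation preserves closability in
both directions, the identity also holds in that case. -/
theorem closure_adjPMap (h : Iso g) (T : H →ₗ.[ℂ] H) :
    (adjPMap U h T).closure = adjPMap U h T.closure := by
  by_cases hT : T.IsClosable
  · refine LinearPMap.eq_of_eq_graph ?_
    rw [← (isClosable_adjPMap U h hT).graph_closure_eq_closure_graph]
    exact graph_adjPMap_topologicalClosure U h hT.graph_closure_eq_closure_graph
  · have hT' : ¬ (adjPMap U h T).IsClosable := fun h1 ↦ hT <| by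
      have := isClosable_adjPMap U h⁻¹ h1
      rwa [adjPMap_inv_adjPMap] at this
    rw [LinearPMap.closure_def' hT, LinearPMap.closure_def' hT']

end Covariance

/-! ### The phase factor and decay on phase space -/

section PhaseSpace

/-- The oscillating factor `e^{-i s s'}` on phase space. -/
def phase (z : Plane × Plane) : ℂ := Complex.exp (-Complex.I * ((inner ℝ z.1 z.2 : ℝ) : ℂ))

theorem hasFDerivAt_phase (z : Plane × Plane) :
    HasFDerivAt phase (phase z • ((-Complex.I) • Complex.ofRealCLM.comp
      ((fderivInnerCLM ℝ (z.1, z.2)).comp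
        ((ContinuousLinearMap.fst ℝ Plane Plane).prod
          (ContinuousLinearMap.snd ℝ Plane Plane))))) z := by
  have h1 : HasFDerivAt (fun z : Plane × Plane ↦ (inner ℝ z.1 z.2 : ℝ)) _ z :=
    (hasFDerivAt_fst (𝕜 := ℝ) (p := z)).inner ℝ hasFDerivAt_snd
  have h2 := (Complex.ofRealCLM.hasFDerivAt.comp z h1).const_smul (-Complex.I)
  exact h2.cexp

theorem contDiff_phase : ContDiff ℝ ∞ phase :=
  (contDiff_const.mul (Complex.ofRealCLM.contDiff.comp (contDiff_fst.inner ℝ contDiff_snd))).cexp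

theorem norm_phase (z : Plane × Plane) : ‖phase z‖ = 1 := by
  rw [phase, neg_mul_comm, mul_comm, ← Complex.ofReal_neg, Complex.norm_exp_ofReal_mul_I]

/-- The four coordinate directions of phase space, each with the coordinate conjugate to it. -/
def phasePairs : List ((Plane × Plane) × (Plane × Plane →L[ℝ] ℝ)) :=
  let e (i : Fin 2) : Plane := EuclideanSpace.single i 1
  let x (i : Fin 2) : Plane →L[ℝ] ℝ := EuclideanSpace.proj i
  let f := ContinuousLinearMap.fst ℝ Plane Plane
  let s := ContinuousLinearMap.snd ℝ Plane Plane
  [((e 0, 0), (x 0).comp s), ((e 1, 0), (x 1).comp s),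
    ((0, e 0), (x 0).comp f), ((0, e 1), (x 1).comp f)]

theorem fderiv_phase {p : (Plane × Plane) × (Plane × Plane →L[ℝ] ℝ)} (hp : p ∈ phasePairs)
    (z : Plane × Plane) : fderiv ℝ phase z p.1 = -Complex.I * (p.2 z : ℂ) * phase z := by
  rw [(hasFDerivAt_phase z).fderiv]
  simp only [phasePairs, List.mem_cons, List.not_mem_nil, or_false] at hp
  rcases hp with rfl | rfl | rfl | rfl <;>
  · simp [EuclideanSpace.inner_single_left, EuclideanSpace.inner_single_right]
    ring

/-- After squaring, this is s₀² + s₁² ≤ (1 + s₀²)(1 + s₁²). -/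
theorem norm_mul_norm_resolventFun_le (s : Plane) :
    ‖s‖ * (‖resolventFun (s 0)‖ * ‖resolventFun (s 1)‖) ≤ 1 := by
  have h0 := norm_resolventFun_sq (s 0)
  have h1 := norm_resolventFun_sq (s 1)
  refine (sq_le_one_iff₀ (by positivity)).1 ?_
  rw [mul_pow, mul_pow, h0, h1, EuclideanSpace.norm_sq_eq, Fin.sum_univ_two, ← mul_inv,
    ← div_eq_mul_inv, div_le_one (by positivity)]
  simp only [Real.norm_eq_abs, sq_abs]
  nlinarith [sq_nonneg (s 0), sq_nonneg (s 1), mul_nonneg (sq_nonneg (s 0)) (sq_nonneg (s 1))]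

/-- The norm of a pair is the larger of the two norms, so one plane absorbs ‖z‖ while the other
factor is at most 1. One round through all four coordinates thus gains a full power of 1 + ‖z‖. -/
theorem partsWeight_phasePairs_mul_le (z : Plane × Plane) :
    partsWeight phasePairs z * (1 + ‖z‖) ≤ 2 := by
  obtain ⟨s, t⟩ := z
  have e : partsWeight phasePairs (s, t) = (‖resolventFun (t 0)‖ * ‖resolventFun (t 1)‖) *
      (‖resolventFun (s 0)‖ * ‖resolventFun (s 1)‖) := by
    simp [partsWeight, phasePairs, mul_assoc]
  have hle : ∀ s : Plane, ‖resolventFun (s 0)‖ * ‖resolventFun (s 1)‖ ≤ 1 := fun s ↦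
    mul_le_one₀ (norm_resolventFun_le_one _) (norm_nonneg _) (norm_resolventFun_le_one _)
  have hnn : ∀ s : Plane, 0 ≤ ‖resolventFun (s 0)‖ * ‖resolventFun (s 1)‖ := fun s ↦ by positivity
  have hs := norm_mul_norm_resolventFun_le s
  have ht := norm_mul_norm_resolventFun_le t
  rw [e, Prod.norm_mk]
  rcases max_choice ‖s‖ ‖t‖ with h | h <;> rw [h] <;>
  nlinarith [hle s, hle t, hnn s, hnn t, norm_nonneg s, norm_nonneg t,
    mul_le_mul_of_nonneg_left hs (hnn t), mul_le_mul_of_nonneg_left ht (hnn s),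
    mul_le_mul (hle s) (hle t) (hnn t) zero_le_one]

/-- Enough integrations by parts to make symbols of weight `1` integrable. -/
def phaseList : List ((Plane × Plane) × (Plane × Plane →L[ℝ] ℝ)) :=
  (List.replicate 6 phasePairs).flatten

theorem mem_phasePairs_of_mem_phaseList {p : (Plane × Plane) × (Plane × Plane →L[ℝ] ℝ)}
    (hp : p ∈ phaseList) : p ∈ phasePairs := by
  obtain ⟨l, hl, hp⟩ := List.mem_flatten.1 hp
  rwa [List.eq_of_mem_replicate hl] at hp

theorem integrable_partsWeight_phaseList :
    Integrable (fun z ↦ partsWeight phaseList z * (1 + ‖z‖)) := by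
  have e : ∀ z, partsWeight phaseList z = partsWeight phasePairs z ^ 6 := fun z ↦ by
    simp only [partsWeight, phaseList, List.map_flatten, List.map_replicate, List.prod_flatten,
      List.prod_replicate]
  have hnn : ∀ z, 0 ≤ partsWeight phasePairs z := fun z ↦
    List.prod_nonneg fun x hx ↦ by
      obtain ⟨p, _, rfl⟩ := List.mem_map.1 hx
      exact norm_nonneg _
  have hc : Continuous fun z ↦ partsWeight phaseList z * (1 + ‖z‖) := by
    refine Continuous.mul ?_ (by fun_prop)
    exact continuous_list_prod _ fun p _ ↦
      (contDiff_resolventFun.continuous.comp p.2.continuous).norm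
  -- Phase space has dimension 4, so the exponent 5 suffices. Six rounds give (2/(1 + ‖z‖))⁶, of
  -- which the extra factor 1 + ‖z‖ uses one power; the constant is 64 = 2⁶.
  have h5 : Integrable (fun z : Plane × Plane ↦ (1 + ‖z‖) ^ (-(5 : ℝ))) :=
    integrable_one_add_norm (by simp; norm_num)
  refine (h5.const_mul 64).mono' hc.aestronglyMeasurable (Filter.Eventually.of_forall fun z ↦ ?_)
  have h1 : 0 < 1 + ‖z‖ := by positivity
  have h2 := partsWeight_phasePairs_mul_le z
  have h3 : (partsWeight phasePairs z * (1 + ‖z‖)) ^ 6 ≤ 2 ^ 6 :=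
    pow_le_pow_left₀ (mul_nonneg (hnn z) h1.le) h2 6
  rw [Real.norm_of_nonneg (mul_nonneg (by rw [e]; exact pow_nonneg (hnn z) 6) h1.le), e,
    Real.rpow_neg h1.le, ← div_eq_mul_inv, le_div_iff₀ (Real.rpow_pos_of_pos h1 _)]
  rw [show (5 : ℝ) = ((5 : ℕ) : ℝ) by norm_num, Real.rpow_natCast]
  calc _ = (partsWeight phasePairs z * (1 + ‖z‖)) ^ 6 := by ring
    _ ≤ 64 := h3.trans (by norm_num)

/-- A smooth function whose translates are images of it under isometries has bounded
derivatives. -/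
theorem isUniformSymbol_of_isometric {V G : Type*} [NormedAddCommGroup V] [NormedSpace ℝ V]
    [NormedAddCommGroup G] [NormedSpace ℝ G] {f : V → G} (hf : ContDiff ℝ ∞ f)
    (hL : ∀ t, ∃ L : G →ₗᵢ[ℝ] G, ∀ s, f (t + s) = L (f s)) :
    IsUniformSymbol (fun _ : Unit ↦ f) (fun _ ↦ 1) := by
  refine ⟨fun _ ↦ hf, fun n ↦ ⟨‖iteratedFDeriv ℝ n f 0‖, fun _ t ↦ ?_⟩⟩
  obtain ⟨L, hL⟩ := hL t
  -- The derivative of f at t is that of L ∘ f at 0, and the isometry L does not change its norm.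
  have h1 := iteratedFDeriv_comp_add_left (𝕜 := ℝ) (f := f) n t 0
  have h2 := L.norm_iteratedFDeriv_comp_left (f := f) (x := 0) (i := n)
    (hf.of_le (by exact_mod_cast le_top)).contDiffAt (le_refl _)
  rw [add_zero, funext hL] at h1
  rw [mul_one, ← h1]
  exact h2.le

end PhaseSpace

/-! ### Convergence of the integrals and smoothness of operators -/

section Convergence

variable {M : Type*} [TopologicalSpace M] [T2Space M]
  [ChartedSpace (EuclideanSpace ℝ (Fin 4)) M]
  [IsManifold (𝓡 4) ∞ M] {H : Type*} [NormedAddCommGroup H] [InnerProductSpace ℂ H]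
  [CompleteSpace H] {g : LorentzMetric M} {𝒜 : CovariantAlgebra H g}
  {ξ : Fin 2 → VField M} {F : H →L[ℂ] H} {Ψ : H}

theorem IsKillingPair.pairFlow_zero (hξ : IsKillingPair g ξ) : pairFlow g ξ 0 = 1 := by
  have h := hξ.pairFlow_add 0 0
  rw [add_zero] at h
  exact left_eq_mul.1 h

theorem IsKillingPair.pairFlow_neg (hξ : IsKillingPair g ξ) (s : Plane) :
    pairFlow g ξ (-s) = (pairFlow g ξ s)⁻¹ :=
  eq_inv_of_mul_eq_one_left (by rw [← hξ.pairFlow_add, neg_add_cancel, hξ.pairFlow_zero])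

/-- The non-oscillating factor of the integrand of the deformed operator. -/
def amplitude (U : Iso g →* unitary (H →L[ℂ] H)) (ξ : Fin 2 → VField M) (lam : ℝ)
    (F : H →L[ℂ] H) (Ψ : H) (z : Plane × Plane) : H :=
  adj U (pairFlow g ξ (lam • Q z.1)) F ((U (pairFlow g ξ z.2) : H →L[ℂ] H) Ψ)

theorem IsKillingPair.integrand_eq (hξ : IsKillingPair g ξ) (U : Iso g →* unitary (H →L[ℂ] H))
    (lam : ℝ) (χ : Plane × Plane → ℂ) (ε : ℝ) (z : Plane × Plane) :
    integrand U ξ lam F Ψ χ ε z = phase z • (χ (ε • z) • amplitude U ξ lam F Ψ z) := by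
  rw [amplitude, adj_apply, ← rep_mul_apply U _ (pairFlow g ξ z.2), ← hξ.pairFlow_neg,
    ← hξ.pairFlow_add, neg_add_eq_sub, smul_smul]
  rfl

/-- Translating s acts on s ↦ α_{φ(s)}(F) and s ↦ U_ξ(s)Ψ by isometries, which bounds all their
derivatives. The amplitude is their pairing under evaluation, after linear changes of variables. -/
theorem IsKillingPair.isUniformSymbol_amplitude (hξ : IsKillingPair g ξ) (lam : ℝ)
    (hF : IsSmoothOp 𝒜 ξ F) (hΨ : Ψ ∈ smoothVectors 𝒜.U) :
    IsUniformSymbol (fun _ : Unit ↦ amplitude 𝒜.U ξ lam F Ψ) (fun _ ↦ 1) := by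
  have hA : IsUniformSymbol (fun _ : Unit ↦ fun s : Plane ↦ adj 𝒜.U (pairFlow g ξ s) F)
      (fun _ ↦ 1) :=
    isUniformSymbol_of_isometric hF.2 fun t ↦ ⟨adjₗᵢ 𝒜.U (pairFlow g ξ t), fun s ↦ by
      rw [hξ.pairFlow_add, adj_mul]
      rfl⟩
  have hv : IsUniformSymbol (fun _ : Unit ↦ fun s : Plane ↦
      (𝒜.U (pairFlow g ξ s) : H →L[ℂ] H) Ψ) (fun _ ↦ 1) :=
    isUniformSymbol_of_isometric (hΨ 2 _ hξ.isSmoothFamily_pairFlow) fun t ↦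
      ⟨repₗᵢ 𝒜.U (pairFlow g ξ t), fun s ↦ by
        rw [hξ.pairFlow_add, rep_mul_apply]
        rfl⟩
  have h1 := (hA.comp_clm ((lam • LinearMap.toContinuousLinearMap Q).comp
    (ContinuousLinearMap.fst ℝ Plane Plane))).bilinear
    ((ContinuousLinearMap.id ℂ (H →L[ℂ] H)).bilinearRestrictScalars ℝ)
    (hv.comp_clm (ContinuousLinearMap.snd ℝ Plane Plane))
  simp only [mul_one] at h1
  exact h1

/-- The witness is the absolutely convergent integral obtained by parts; χ does not occur in it, so
one value serves all cutoffs. -/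
theorem IsKillingPair.exists_hasDeformedValue (hξ : IsKillingPair g ξ) (lam : ℝ)
    (hF : IsSmoothOp 𝒜 ξ F) (hΨ : Ψ ∈ smoothVectors 𝒜.U) :
    ∃ Φ, HasDeformedValue 𝒜.U ξ lam F Ψ Φ := by
  have ha := hξ.isUniformSymbol_amplitude lam hF hΨ
  refine ⟨(1 / (4 * (Real.pi : ℂ) ^ 2)) •
    ∫ z, phase z • partsOps phaseList (amplitude 𝒜.U ξ lam F Ψ) z,
    fun χ hχ ↦ ⟨fun ε hε ↦ ?_, ?_⟩⟩
  rotate_left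
  · simp only [hξ.integrand_eq]
    exact (tendsto_oscillatory contDiff_phase (fun z ↦ (norm_phase z).le)
      (fun p hp z ↦ fderiv_phase (mem_phasePairs_of_mem_phaseList hp) z)
      integrable_partsWeight_phaseList ha hχ.contDiff hχ.hasCompactSupport
      hχ.apply_zero).const_smul _
  · rw [funext (hξ.integrand_eq 𝒜.U lam χ ε)]
    refine Continuous.integrable_of_hasCompactSupport ?_ ?_
    · exact contDiff_phase.continuous.smul
        ((hχ.contDiff.continuous.comp (continuous_const_smul ε)).smul (ha.1 ()).continuous)
    · exact HasCompactSupport.smul_left (hχ.hasCompactSupport.comp_smul hε.ne').smul_right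

/-! #### Smooth operators -/

theorem IsSmoothOp.pushforward (hF : IsSmoothOp 𝒜 ξ F) (hξ : IsKillingPair g ξ) (h : Iso g) :
    IsSmoothOp 𝒜 (pushforward h ξ) (adj 𝒜.U h F) := by
  refine ⟨𝒜.invariant h F hF.1, ?_⟩
  have e : (fun s ↦ adj 𝒜.U (pairFlow g (Warped.pushforward h ξ) s) (adj 𝒜.U h F))
      = fun s ↦ adjₗᵢ 𝒜.U h (adj 𝒜.U (pairFlow g ξ s) F) := by
    ext1 s
    rw [hξ.pairFlow_pushforward, ← adj_mul, inv_mul_cancel_right, adj_mul]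
    rfl
  rw [e]
  exact (adjₗᵢ 𝒜.U h).contDiff.comp hF.2

theorem IsSmoothOp.linComb (hF : IsSmoothOp 𝒜 ξ F) (hξ : IsKillingPair g ξ) (N : GL (Fin 2) ℝ) :
    IsSmoothOp 𝒜 (linComb N.1 ξ) F := by
  refine ⟨hF.1, ?_⟩
  simp only [hξ.pairFlow_linComb]
  exact hF.2.comp (planeEquiv (transposeGL N)).contDiff

omit [T2Space M] [IsManifold (𝓡 4) ∞ M] in
theorem inverted_eq_linComb (ξ : Fin 2 → VField M) :
    inverted ξ = linComb !![0, 1; 1, 0] ξ := by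
  funext i p
  fin_cases i <;> simp [inverted, linComb]

theorem IsKillingPair.deformed_linComb (hξ : IsKillingPair g ξ) (U : Iso g →* unitary (H →L[ℂ] H))
    (lam : ℝ) (N : GL (Fin 2) ℝ) :
    deformed U (linComb N.1 ξ) lam F = deformed U ξ (N.1.det * lam) F :=
  congrArg LinearPMap.closure
    (deformedCore_congr U fun _ _ ↦ hξ.hasDeformedValue_linComb_iff U N)

end Convergence

end Warped

end

/-! ### The theorem -/

open Warped in
theorem lemma3p3 {M : Type*} [TopologicalSpace M] [T2Space M] [ConnectedSpace M]
    [ChartedSpace (EuclideanSpace ℝ (Fin 4)) M] [IsManifold (𝓡 4) ∞ M] (g : LorentzMetric M)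
    {H : Type*} [NormedAddCommGroup H] [InnerProductSpace ℂ H] [CompleteSpace H]
    (𝒜 : CovariantAlgebra H g) (ξ : Fin 2 → VField M) (hξ : IsKillingPair g ξ) (lam : ℝ)
    (F : H →L[ℂ] H) (hF : IsSmoothOp 𝒜 ξ F) :
    (deformedCore 𝒜.U ξ lam F).domain = smoothVectors 𝒜.U ∧
    (∀ h : Iso g,
      IsKillingPair g (pushforward h ξ) ∧
      IsSmoothOp 𝒜 (pushforward h ξ) (adj 𝒜.U h F) ∧
      adjPMap 𝒜.U h (deformed 𝒜.U ξ lam F) =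
        deformed 𝒜.U (pushforward h ξ) lam (adj 𝒜.U h F)) ∧
    (∀ N : GL (Fin 2) ℝ,
      IsKillingPair g (linComb N.1 ξ) ∧
      IsSmoothOp 𝒜 (linComb N.1 ξ) F ∧
      deformed 𝒜.U (linComb N.1 ξ) lam F = deformed 𝒜.U ξ (N.1.det * lam) F) ∧
    deformed 𝒜.U (inverted ξ) lam F = deformed 𝒜.U ξ (-lam) F := by
  refine ⟨?_, fun h ↦ ⟨hξ.pushforward h, hF.pushforward hξ h, ?_⟩,
    fun N ↦ ⟨hξ.linComb N, hF.linComb hξ N, hξ.deformed_linComb 𝒜.U lam N⟩, ?_⟩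
  · ext Ψ
    exact ⟨fun h ↦ h.1, fun h ↦ ⟨h, hξ.exists_hasDeformedValue lam hF h⟩⟩
  -- Covariance is known before closure; conjugation is first moved inside the closure.
  · rw [deformed, deformed, ← closure_adjPMap, hξ.adjPMap_deformedCore]
  · have hdet : (!![0, 1; 1, 0] : Matrix (Fin 2) (Fin 2) ℝ).det = -1 := by
      simp [Matrix.det_fin_two]
    have h := hξ.deformed_linComb (F := F) 𝒜.U lam
      (Matrix.GeneralLinearGroup.mkOfDetNeZero !![0, 1; 1, 0] (by rw [hdet]; norm_num))
    rw [inverted_eq_linComb]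
    refine h.trans ?_
    change deformed 𝒜.U ξ ((!![0, 1; 1, 0] : Matrix (Fin 2) (Fin 2) ℝ).det * lam) F = _
    rw [hdet, neg_one_mul]
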